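/- Let $\mathbf k$ be a field of characteristic $0$ and $\mathcal J_0=\mathbb N\times\mathbb N_0\setminus\{(1,0),(1,1)\}$, where $\mathbb N=\{1,2,\dots\}$. A *dioperad* (non-unital, with operations of zero inputs allowed) consists of graded $\mathbf k$-vector spaces $\mathcal P(m,n)$ ($m$ outputs, $n$ inputs, $(m,n)\in\mathcal J_0$) with commuting left actions of $\mathbb S_m$ and right actions of $\mathbb S_n$, and degree $0$ compositions ${}_i\circ_j:\mathcal P(m_1,n_1)\otimes\mathcal P(m_2,n_2)\to\mathcal P(m_1+m_2-1,n_1+n_2-1)$, for $1\le i\le n_1$ and $1\le j\le m_2$ (output $j$ of the second operation is plugged into input $i$ of the first), which are equivariant and satisfy the usual associativity axioms, with Koszul signs. Let $\mathcal F_0(E)$ be the free dioperad on a collection $E$ of graded bimodules. If $E$ is concentrated in arities $(1,2)$ and $(2,0)$, then $\mathcal F_0(E)(1,3)=\mathrm{Ind}_{\mathbb S_2}^{\mathbb S_3}(E(1,2)\otimes E(1,2))$ and $\mathcal F_0(E)(2,1)=\mathrm{Ind}_{1}^{\mathbb S_2}(E(1,2)\otimes E(2,0))$. For a right $\mathbb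 S_3$-submodule $R(1,3)\subset\mathcal F_0(E)(1,3)$ and a left $\mathbb S_2$-submodule $R(2,1)\subset\mathcal F_0(E)(2,1)$, the *quadratic dioperad* $\langle E;R\rangle$ is the quotient of $\mathcal F_0(E)$ by the ideal generated by $R$. When $E$ is finite-dimensional, the *quadratic dual* of $\mathcal P=\langle E;R\rangle$ is $\mathcal P^!=\langle E^\vee;R^\perp\rangle$. Here $E^\vee(m,n)=E(m,n)^*\otimes \mathrm{Sgn}_n$ for $(m,n)=(1,2),(2,0)$, with $(E^*)^p=(E^{-p})^*$, the dual representation on $E(m,n)^*$, and $\mathrm{Sgn}_n$ the sign representation of $\mathbb S_n$ with trivial $\mathbb S_m$-action. Moreover $R^\perp$ is the orthogonal complement of $R$ under the natural pairing of trees with two vertices: in arity $(1,3)$ the tree $(x\,{}_1\circ_1\,y)\sigma$ is paired with $(f\,{}_1\circ_1\,g)\sigma$ by $\mathrm{sgn}(\sigma)\,(-1)^{|y||f|}x(f)\,y(g)$, in arity $(2,1)$ the tree $\pi(x\,{}_1\circ_1\,y)$ is paired with $\pi(f\,{}_1\circ_1\,g)$ by $(-1)^{|y||f|}x(f)\,y(g)$,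 and trees in different summands of the induced module are orthogonal. For $d\in\mathbb Z$ let $\mathcal V^{(d)}=\langle E;R\rangle$ be the quadratic dioperad with generators $E(1,2)=\mathbf k\mu\oplus\mathbf k\bar\mu$ in degree $0$, on which the transposition $\sigma\in\mathbb S_2$ acts by interchanging $\mu$ and $\bar\mu$, and $E(2,0)=\mathbf k\nu$ in degree $d$, on which $\mathbb S_2$ acts trivially. The relations $R$ are generated by associativity and invariance, $$\mu\,{}_1\circ_1\,\mu=\mu\,{}_2\circ_1\,\mu,\qquad \mu\,{}_1\circ_2\,\nu=\mu\,{}_2\circ_1\,\nu .$$ Let $\mu^*,\bar\mu^*,\nu^*$ be the generators of $(\mathcal V^{(d)})^!$ given by the dual bases of $\mu,\bar\mu$ and of $\nu$. **Proposition.** For every $d\in\mathbb Z$: 1. In $\mathcal V^{(d)}$ the product $\mu$ is associative, and the co-inner product $\nu$, of degree $d$, is symmetric and invariant with respect to $\mu$. 2. One has $\sigma.\mu^*=-\bar\mu^*$ and $\sigma.\nu^*=\nu^*$. Here $\mu^*$ has degree $0$ and $\nu^*$ has degree $-d$. 3. In $(\mathcal V^{(d)})^!$ the relations $\mu^*\,{}_1\circ_1\,\mu^*=\mu^*\,{}_2\circ_1\,\mu^*$,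 $\ \sigma.\nu^*=\nu^*$ and $\mu^*\,{}_1\circ_2\,\nu^*=\mu^*\,{}_2\circ_1\,\nu^*$ hold. 4. The quadratic dual of $\mathcal V^{(d)}$ is $(\mathcal V^{(d)})^!=\mathcal V^{(-d)}$: there is an isomorphism of dioperads $\mathcal V^{(-d)}\cong(\mathcal V^{(d)})^!$ which sends the generator $\mu$ to $\mu^*$ and the generator $\nu$ to $\nu^*$. -/

import Mathlib

open scoped TensorProduct DirectSum
universe u

noncomputable section


/-- The index set `J₀ = ℕ × ℕ₀ - {(1,0), (1,1)}` of arities: `m ≥ 1` outputs and `n ≥ 0` inputs. -/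
def InJ0 (m n : ℕ) : Prop := 1 ≤ m ∧ (m, n) ≠ (1, 0) ∧ (m, n) ≠ (1, 1)

/-- The underlying map of the block permutation `((12)(45))_{a,b,c,d,e}`, with positions counted
from `0`. -/
def blockSwapFun (a b c d e x : ℕ) : ℕ :=
  if x < a then x + b
  else if x < a + b then x - a
  else if x < a + b + c then x
  else if x < a + b + c + d then x + e
  else x - d

/-- The block permutation `((12)(45))_{a,b,c,d,e}` of `a + b + c + d + e` letters: it exchanges the
first two blocks and the last two blocks. -/
def blockSwap {N : ℕ} (a b c d e : ℕ) (h : a + b + c + d + e = N) : Equiv.Perm (Fin N) where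
  toFun x := ⟨blockSwapFun a b c d e x, by have := x.isLt; unfold blockSwapFun; split_ifs <;> omega⟩
  invFun x := ⟨blockSwapFun b a c e d x, by have := x.isLt; unfold blockSwapFun; split_ifs <;> omega⟩
  left_inv x := by
    have := x.isLt; ext; simp only [blockSwapFun]; split_ifs <;> omega
  right_inv x := by
    have := x.isLt; ext; simp only [blockSwapFun]; split_ifs <;> omega

/-- The slots of a composite: replacing the slot `i` among `a` slots by a row of `b` slots gives
`c = a + b - 1` slots. A slot different from `i` keeps its place up to a shift, and the new slots
occupy the places `i, …, i + b - 1`. -/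
def slotEquiv {a b c : ℕ} (h : c + 1 = a + b) (i : Fin a) :
    {x : Fin a // x ≠ i} ⊕ Fin b ≃ Fin c where
  toFun
    | Sum.inl x => if hx : x.1.val < i.val then ⟨x.1.val, by omega⟩
        else ⟨x.1.val + b - 1, by
          have h1 := x.1.isLt
          have h2 : x.1.val ≠ i.val := fun e => x.2 (Fin.ext e)
          omega⟩
    | Sum.inr y => ⟨i.val + y.val, by have := i.isLt; have := y.isLt; omega⟩
  invFun z :=
    if h1 : z.val < i.val then Sum.inl ⟨⟨z.val, by have := i.isLt; omega⟩, fun e => by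
        rw [← e] at h1; simp at h1⟩
    else if h2 : z.val < i.val + b then Sum.inr ⟨z.val - i.val, by omega⟩
    else Sum.inl ⟨⟨z.val + 1 - b, by have := z.isLt; omega⟩, fun e => by
        rw [← e] at h1 h2; simp at h1 h2; omega⟩
  left_inv s := by
    rcases s with ⟨x, hx⟩ | y
    · have h1 := x.isLt
      have h2 : x.val ≠ i.val := fun e => hx (Fin.ext e)
      by_cases h3 : x.val < i.val
      · simp [h3]
      · have h4 : ¬ (x.val + b - 1 < i.val) := by omega
        have h5 : ¬ (x.val + b - 1 < i.val + b) := by omega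
        simp only [h3, h4, h5, dite_false]
        congr 2
        ext
        simp only
        omega
    · simp
  right_inv z := by
    have h0 := z.isLt
    by_cases h1 : z.val < i.val
    · simp [h1]
    · by_cases h2 : z.val < i.val + b
      · simp only [h1, h2, dite_true, dite_false]
        ext
        simp only
        omega
      · have h3 : ¬ (z.val + 1 - b < i.val) := by omega
        simp only [h1, h2, h3, dite_false]
        ext
        simp only
        omega

/-- The permutation `σ ∘ᵢ τ`: the block permutation of `σ` for the blocks `1,…,1,b,1,…,1` (the block
of size `b` standing at place `i`) composed with `τ` inside that block. The case `b = 0` is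
allowed. -/
def permComp {a b c : ℕ} (h : c + 1 = a + b) (σ : Equiv.Perm (Fin a)) (i : Fin a)
    (τ : Equiv.Perm (Fin b)) : Equiv.Perm (Fin c) :=
  (slotEquiv h i).symm.trans
    ((Equiv.sumCongr
      (σ.subtypeEquiv (p := fun x => x ≠ i) (q := fun x => x ≠ σ i)
        (fun _ => (σ.injective.ne_iff).symm)) τ).trans
      (slotEquiv h (σ i)))

/-- A collection `E = {E(m,n)}` of graded `k`-vector spaces with commuting left actions of `S_m` and
right actions of `S_n`. Here `obj m n p` is the degree `p` part of the space with `m` outputs and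
`n` inputs, and `act π σ x` is `π x σ`. The collection is indexed by the arities in `J₀`, which is
expressed by being zero at the others. All differentials are zero. -/
structure SBimodule (k : Type u) [Field k] where
  obj : ℕ → ℕ → ℤ → Type u
  [grp : ∀ m n p, AddCommGroup (obj m n p)]
  [mod : ∀ m n p, Module k (obj m n p)]
  act : ∀ {m n : ℕ} {p : ℤ}, Equiv.Perm (Fin m) → Equiv.Perm (Fin n) → (obj m n p →ₗ[k] obj m n p)
  act_one : ∀ {m n : ℕ} {p : ℤ} (x : obj m n p), act 1 1 x = x
  act_mul : ∀ {m n : ℕ} {p : ℤ} (π π' : Equiv.Perm (Fin m)) (σ σ' : Equiv.Perm (Fin n))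
    (x : obj m n p), act (π * π') (σ' * σ) x = act π σ (act π' σ' x)
  eq_zero_of_not_inJ0 : ∀ {m n : ℕ} {p : ℤ}, ¬ InJ0 m n → ∀ x : obj m n p, x = 0

attribute [instance] SBimodule.grp SBimodule.mod

/-- A dioperad (without unit, with operations of zero inputs allowed) in graded vector spaces with
zero differential. `comp _ _ _ i j f g` is the composition `f ᵢ∘ⱼ g`, which plugs the output `j` of
`g` into the input `i` of `f`; inputs and outputs are counted from `0`. The axioms `assoc_in_*` are
the three cases of `ᵢ∘ⱼ (κ∘ₗ ⊗ id)`, the axioms `assoc_out_*` are the three cases of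
`ᵢ∘ⱼ (id ⊗ κ∘ₗ)`, and `comp_act` is equivariance. The signs come from the symmetry isomorphism of
graded vector spaces. -/
structure Dioperad (k : Type u) [Field k] extends SBimodule k where
  comp : ∀ {m₁ n₁ m₂ n₂ m n : ℕ} {p₁ p₂ p : ℤ}, m + 1 = m₁ + m₂ → n + 1 = n₁ + n₂ → p₁ + p₂ = p →
    Fin n₁ → Fin m₂ → (obj m₁ n₁ p₁ →ₗ[k] obj m₂ n₂ p₂ →ₗ[k] obj m n p)
  assoc_in_lt : ∀ {m₁ n₁ m₂ n₂ m₃ n₃ m₁₂ n₁₂ m₁₃ n₁₃ m n : ℕ} {p₁ p₂ p₃ p₁₂ p₁₃ p : ℤ}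
    (hm₁₂ : m₁₂ + 1 = m₁ + m₂) (hn₁₂ : n₁₂ + 1 = n₁ + n₂) (hp₁₂ : p₁ + p₂ = p₁₂)
    (hm₁₃ : m₁₃ + 1 = m₁ + m₃) (hn₁₃ : n₁₃ + 1 = n₁ + n₃) (hp₁₃ : p₁ + p₃ = p₁₃)
    (hm : m + 1 = m₁₂ + m₃) (hn : n + 1 = n₁₂ + n₃) (hp : p₁₂ + p₃ = p)
    (i : Fin n₁₂) (j : Fin m₃) (κ : Fin n₁) (l : Fin m₂) (_ : i.val < κ.val)
    (f : obj m₁ n₁ p₁) (g : obj m₂ n₂ p₂) (h : obj m₃ n₃ p₃),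
    comp hm hn hp i j (comp hm₁₂ hn₁₂ hp₁₂ κ l f g) h =
      (-1 : k) ^ (p₂ * p₃) •
        act (blockSwap l.val j.val m₁ (m₃ - 1 - j.val) (m₂ - 1 - l.val) (by omega)) 1
          (comp (by omega) (by omega) (by omega) ⟨κ.val + n₃ - 1, by omega⟩ l
            (comp hm₁₃ hn₁₃ hp₁₃ ⟨i.val, by omega⟩ j f h) g)
  assoc_in_mid : ∀ {m₁ n₁ m₂ n₂ m₃ n₃ m₁₂ n₁₂ m₂₃ n₂₃ m n : ℕ} {p₁ p₂ p₃ p₁₂ p₂₃ p : ℤ}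
    (hm₁₂ : m₁₂ + 1 = m₁ + m₂) (hn₁₂ : n₁₂ + 1 = n₁ + n₂) (hp₁₂ : p₁ + p₂ = p₁₂)
    (hm₂₃ : m₂₃ + 1 = m₂ + m₃) (hn₂₃ : n₂₃ + 1 = n₂ + n₃) (hp₂₃ : p₂ + p₃ = p₂₃)
    (hm : m + 1 = m₁₂ + m₃) (hn : n + 1 = n₁₂ + n₃) (hp : p₁₂ + p₃ = p)
    (i : Fin n₁₂) (j : Fin m₃) (κ : Fin n₁) (l : Fin m₂)
    (_ : κ.val ≤ i.val) (_ : i.val < κ.val + n₂)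
    (f : obj m₁ n₁ p₁) (g : obj m₂ n₂ p₂) (h : obj m₃ n₃ p₃),
    comp hm hn hp i j (comp hm₁₂ hn₁₂ hp₁₂ κ l f g) h =
      comp (by omega) (by omega) (by omega) κ ⟨j.val + l.val, by omega⟩ f
        (comp hm₂₃ hn₂₃ hp₂₃ ⟨i.val - κ.val, by omega⟩ j g h)
  assoc_in_gt : ∀ {m₁ n₁ m₂ n₂ m₃ n₃ m₁₂ n₁₂ m₁₃ n₁₃ m n : ℕ} {p₁ p₂ p₃ p₁₂ p₁₃ p : ℤ}
    (hm₁₂ : m₁₂ + 1 = m₁ + m₂) (hn₁₂ : n₁₂ + 1 = n₁ + n₂) (hp₁₂ : p₁ + p₂ = p₁₂)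
    (hm₁₃ : m₁₃ + 1 = m₁ + m₃) (hn₁₃ : n₁₃ + 1 = n₁ + n₃) (hp₁₃ : p₁ + p₃ = p₁₃)
    (hm : m + 1 = m₁₂ + m₃) (hn : n + 1 = n₁₂ + n₃) (hp : p₁₂ + p₃ = p)
    (i : Fin n₁₂) (j : Fin m₃) (κ : Fin n₁) (l : Fin m₂) (_ : κ.val + n₂ ≤ i.val)
    (f : obj m₁ n₁ p₁) (g : obj m₂ n₂ p₂) (h : obj m₃ n₃ p₃),
    comp hm hn hp i j (comp hm₁₂ hn₁₂ hp₁₂ κ l f g) h =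
      (-1 : k) ^ (p₂ * p₃) •
        act (blockSwap l.val j.val m₁ (m₃ - 1 - j.val) (m₂ - 1 - l.val) (by omega)) 1
          (comp (by omega) (by omega) (by omega) ⟨κ.val, by omega⟩ l
            (comp hm₁₃ hn₁₃ hp₁₃ ⟨i.val + 1 - n₂, by omega⟩ j f h) g)
  assoc_out_lt : ∀ {m₁ n₁ m₂ n₂ m₃ n₃ m₂₃ n₂₃ m₁₃ n₁₃ m n : ℕ} {p₁ p₂ p₃ p₂₃ p₁₃ p : ℤ}
    (hm₂₃ : m₂₃ + 1 = m₂ + m₃) (hn₂₃ : n₂₃ + 1 = n₂ + n₃) (hp₂₃ : p₂ + p₃ = p₂₃)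
    (hm₁₃ : m₁₃ + 1 = m₁ + m₃) (hn₁₃ : n₁₃ + 1 = n₁ + n₃) (hp₁₃ : p₁ + p₃ = p₁₃)
    (hm : m + 1 = m₁ + m₂₃) (hn : n + 1 = n₁ + n₂₃) (hp : p₁ + p₂₃ = p)
    (i : Fin n₁) (j : Fin m₂₃) (κ : Fin n₂) (l : Fin m₃) (_ : j.val < l.val)
    (f : obj m₁ n₁ p₁) (g : obj m₂ n₂ p₂) (h : obj m₃ n₃ p₃),
    comp hm hn hp i j f (comp hm₂₃ hn₂₃ hp₂₃ κ l g h) =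
      (-1 : k) ^ (p₁ * p₂) •
        act 1 (blockSwap i.val κ.val n₃ (n₂ - 1 - κ.val) (n₁ - 1 - i.val) (by omega))
          (comp (by omega) (by omega) (by omega) κ ⟨l.val + m₁ - 1, by omega⟩ g
            (comp hm₁₃ hn₁₃ hp₁₃ i ⟨j.val, by omega⟩ f h))
  assoc_out_mid : ∀ {m₁ n₁ m₂ n₂ m₃ n₃ m₂₃ n₂₃ m₁₂ n₁₂ m n : ℕ} {p₁ p₂ p₃ p₂₃ p₁₂ p : ℤ}
    (hm₂₃ : m₂₃ + 1 = m₂ + m₃) (hn₂₃ : n₂₃ + 1 = n₂ + n₃) (hp₂₃ : p₂ + p₃ = p₂₃)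
    (hm₁₂ : m₁₂ + 1 = m₁ + m₂) (hn₁₂ : n₁₂ + 1 = n₁ + n₂) (hp₁₂ : p₁ + p₂ = p₁₂)
    (hm : m + 1 = m₁ + m₂₃) (hn : n + 1 = n₁ + n₂₃) (hp : p₁ + p₂₃ = p)
    (i : Fin n₁) (j : Fin m₂₃) (κ : Fin n₂) (l : Fin m₃)
    (_ : l.val ≤ j.val) (_ : j.val < l.val + m₂)
    (f : obj m₁ n₁ p₁) (g : obj m₂ n₂ p₂) (h : obj m₃ n₃ p₃),
    comp hm hn hp i j f (comp hm₂₃ hn₂₃ hp₂₃ κ l g h) =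
      comp (by omega) (by omega) (by omega) ⟨κ.val + i.val, by omega⟩ l
        (comp hm₁₂ hn₁₂ hp₁₂ i ⟨j.val - l.val, by omega⟩ f g) h
  assoc_out_gt : ∀ {m₁ n₁ m₂ n₂ m₃ n₃ m₂₃ n₂₃ m₁₃ n₁₃ m n : ℕ} {p₁ p₂ p₃ p₂₃ p₁₃ p : ℤ}
    (hm₂₃ : m₂₃ + 1 = m₂ + m₃) (hn₂₃ : n₂₃ + 1 = n₂ + n₃) (hp₂₃ : p₂ + p₃ = p₂₃)
    (hm₁₃ : m₁₃ + 1 = m₁ + m₃) (hn₁₃ : n₁₃ + 1 = n₁ + n₃) (hp₁₃ : p₁ + p₃ = p₁₃)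
    (hm : m + 1 = m₁ + m₂₃) (hn : n + 1 = n₁ + n₂₃) (hp : p₁ + p₂₃ = p)
    (i : Fin n₁) (j : Fin m₂₃) (κ : Fin n₂) (l : Fin m₃) (_ : l.val + m₂ ≤ j.val)
    (f : obj m₁ n₁ p₁) (g : obj m₂ n₂ p₂) (h : obj m₃ n₃ p₃),
    comp hm hn hp i j f (comp hm₂₃ hn₂₃ hp₂₃ κ l g h) =
      (-1 : k) ^ (p₁ * p₂) •
        act 1 (blockSwap i.val κ.val n₃ (n₂ - 1 - κ.val) (n₁ - 1 - i.val) (by omega))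
          (comp (by omega) (by omega) (by omega) κ ⟨l.val, by omega⟩ g
            (comp hm₁₃ hn₁₃ hp₁₃ i ⟨j.val + 1 - m₂, by omega⟩ f h))
  comp_act : ∀ {m₁ n₁ m₂ n₂ m n : ℕ} {p₁ p₂ p : ℤ}
    (hm : m + 1 = m₁ + m₂) (hn : n + 1 = n₁ + n₂) (hp : p₁ + p₂ = p) (i : Fin n₁) (j : Fin m₂)
    (π₁ : Equiv.Perm (Fin m₁)) (σ₁ : Equiv.Perm (Fin n₁))
    (π₂ : Equiv.Perm (Fin m₂)) (σ₂ : Equiv.Perm (Fin n₂))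
    (f : obj m₁ n₁ p₁) (g : obj m₂ n₂ p₂),
    comp hm hn hp i j (act π₁ σ₁ f) (act π₂ σ₂ g) =
      act (permComp (by omega) π₂ (π₂⁻¹ j) π₁) (permComp hn σ₁ i σ₂)
        (comp hm hn hp (σ₁ i) (π₂⁻¹ j) f g)

/-- A morphism of collections of bimodules. -/
structure SBimoduleHom {k : Type u} [Field k] (E P : SBimodule k) where
  map : ∀ {m n : ℕ} {p : ℤ}, E.obj m n p →ₗ[k] P.obj m n p
  map_act : ∀ {m n : ℕ} {p : ℤ} (π : Equiv.Perm (Fin m)) (σ : Equiv.Perm (Fin n))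
    (x : E.obj m n p), map (E.act π σ x) = P.act π σ (map x)

/-- An isomorphism of dioperads: bijective linear maps in every arity and degree which are compatible
with the symmetric group actions and with all compositions. -/
structure DioperadIso {k : Type u} [Field k] (P Q : Dioperad k) where
  equiv : ∀ {m n : ℕ} {p : ℤ}, P.obj m n p ≃ₗ[k] Q.obj m n p
  map_act : ∀ {m n : ℕ} {p : ℤ} (π : Equiv.Perm (Fin m)) (σ : Equiv.Perm (Fin n))
    (x : P.obj m n p), equiv (P.act π σ x) = Q.act π σ (equiv x)
  map_comp : ∀ {m₁ n₁ m₂ n₂ m n : ℕ} {p₁ p₂ p : ℤ}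
    (hm : m + 1 = m₁ + m₂) (hn : n + 1 = n₁ + n₂) (hp : p₁ + p₂ = p) (i : Fin n₁) (j : Fin m₂)
    (f : P.obj m₁ n₁ p₁) (g : P.obj m₂ n₂ p₂),
    equiv (P.comp hm hn hp i j f g) = Q.comp hm hn hp i j (equiv f) (equiv g)

/-- An ideal of a dioperad. -/
structure DioperadIdeal {k : Type u} [Field k] (P : Dioperad k) where
  carrier : ∀ m n p, Submodule k (P.obj m n p)
  act_mem : ∀ {m n : ℕ} {p : ℤ} (π : Equiv.Perm (Fin m)) (σ : Equiv.Perm (Fin n))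
    {x : P.obj m n p}, x ∈ carrier m n p → P.act π σ x ∈ carrier m n p
  comp_mem_left : ∀ {m₁ n₁ m₂ n₂ m n : ℕ} {p₁ p₂ p : ℤ}
    (hm : m + 1 = m₁ + m₂) (hn : n + 1 = n₁ + n₂) (hp : p₁ + p₂ = p) (i : Fin n₁) (j : Fin m₂)
    {f : P.obj m₁ n₁ p₁} (g : P.obj m₂ n₂ p₂), f ∈ carrier m₁ n₁ p₁ →
    P.comp hm hn hp i j f g ∈ carrier m n p
  comp_mem_right : ∀ {m₁ n₁ m₂ n₂ m n : ℕ} {p₁ p₂ p : ℤ}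
    (hm : m + 1 = m₁ + m₂) (hn : n + 1 = n₁ + n₂) (hp : p₁ + p₂ = p) (i : Fin n₁) (j : Fin m₂)
    (f : P.obj m₁ n₁ p₁) {g : P.obj m₂ n₂ p₂}, g ∈ carrier m₂ n₂ p₂ →
    P.comp hm hn hp i j f g ∈ carrier m n p

/-- The ideal generated by a family of subsets: the intersection of all ideals that contain it. -/
def DioperadIdeal.span {k : Type u} [Field k] {P : Dioperad k} (S : ∀ m n p, Set (P.obj m n p)) :
    DioperadIdeal P where
  carrier m n p := sInf {N | ∃ I : DioperadIdeal P,
    (∀ m' n' p', S m' n' p' ⊆ I.carrier m' n' p') ∧ N = I.carrier m n p}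
  act_mem π σ x hx := by
    simp only [Submodule.mem_sInf, Set.mem_ofPred_eq] at hx ⊢
    rintro N ⟨I, hI, rfl⟩
    exact I.act_mem π σ (hx _ ⟨I, hI, rfl⟩)
  comp_mem_left hm hn hp i j f g hf := by
    simp only [Submodule.mem_sInf, Set.mem_ofPred_eq] at hf ⊢
    rintro N ⟨I, hI, rfl⟩
    exact I.comp_mem_left hm hn hp i j g (hf _ ⟨I, hI, rfl⟩)
  comp_mem_right hm hn hp i j f g hg := by
    simp only [Submodule.mem_sInf, Set.mem_ofPred_eq] at hg ⊢
    rintro N ⟨I, hI, rfl⟩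
    exact I.comp_mem_right hm hn hp i j f (hg _ ⟨I, hI, rfl⟩)

/-- A bilinear map descends to quotients. -/
def quotBilin {k : Type u} [Field k] {M₁ M₂ M₃ : Type u} [AddCommGroup M₁] [AddCommGroup M₂]
    [AddCommGroup M₃] [Module k M₁] [Module k M₂] [Module k M₃]
    (N₁ : Submodule k M₁) (N₂ : Submodule k M₂) (N₃ : Submodule k M₃)
    (B : M₁ →ₗ[k] M₂ →ₗ[k] M₃)
    (h₁ : ∀ x ∈ N₁, ∀ y, B x y ∈ N₃) (h₂ : ∀ x, ∀ y ∈ N₂, B x y ∈ N₃) :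
    (M₁ ⧸ N₁) →ₗ[k] (M₂ ⧸ N₂) →ₗ[k] (M₃ ⧸ N₃) :=
  N₁.liftQ
    (LinearMap.flip (N₂.liftQ (LinearMap.flip (B.compr₂ N₃.mkQ)) (by
      intro y hy
      rw [LinearMap.mem_ker]
      ext x
      simpa using h₂ x y hy)))
    (by
      intro x hx
      rw [LinearMap.mem_ker]
      ext y
      simpa using h₁ x hx y)

theorem quotBilin_mk {k : Type u} [Field k] {M₁ M₂ M₃ : Type u} [AddCommGroup M₁] [AddCommGroup M₂]
    [AddCommGroup M₃] [Module k M₁] [Module k M₂] [Module k M₃]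
    (N₁ : Submodule k M₁) (N₂ : Submodule k M₂) (N₃ : Submodule k M₃)
    (B : M₁ →ₗ[k] M₂ →ₗ[k] M₃)
    (h₁ : ∀ x ∈ N₁, ∀ y, B x y ∈ N₃) (h₂ : ∀ x, ∀ y ∈ N₂, B x y ∈ N₃) (x : M₁) (y : M₂) :
    quotBilin N₁ N₂ N₃ B h₁ h₂ (N₁.mkQ x) (N₂.mkQ y) = N₃.mkQ (B x y) := rfl

/-- The quotient `P / I` of a dioperad by an ideal. -/
def Dioperad.quotient {k : Type u} [Field k] (P : Dioperad k) (I : DioperadIdeal P) :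
    Dioperad k where
  obj m n p := P.obj m n p ⧸ I.carrier m n p
  act {m n p} π σ := (I.carrier m n p).mapQ (I.carrier m n p) (P.act π σ)
    (fun _ hx => I.act_mem π σ hx)
  act_one x := by
    obtain ⟨x, rfl⟩ := Submodule.mkQ_surjective _ x
    exact congrArg _ (P.act_one x)
  act_mul π π' σ σ' x := by
    obtain ⟨x, rfl⟩ := Submodule.mkQ_surjective _ x
    exact congrArg _ (P.act_mul π π' σ σ' x)
  eq_zero_of_not_inJ0 h x := by
    obtain ⟨x, rfl⟩ := Submodule.mkQ_surjective _ x
    rw [P.eq_zero_of_not_inJ0 h x, map_zero]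
  comp hm hn hp i j := quotBilin _ _ _ (P.comp hm hn hp i j)
    (fun _ hx y => I.comp_mem_left hm hn hp i j y hx)
    (fun x _ hy => I.comp_mem_right hm hn hp i j x hy)
  assoc_in_lt := by
    intros
    rename_i f g h
    obtain ⟨f, rfl⟩ := Submodule.mkQ_surjective _ f
    obtain ⟨g, rfl⟩ := Submodule.mkQ_surjective _ g
    obtain ⟨h, rfl⟩ := Submodule.mkQ_surjective _ h
    exact congrArg (Submodule.mkQ _) (P.assoc_in_lt (by assumption) (by assumption) (by assumption)
      (by assumption) (by assumption) (by assumption) (by assumption) (by assumption)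
      (by assumption) _ _ _ _ (by assumption) f g h)
  assoc_in_mid := by
    intros
    rename_i f g h
    obtain ⟨f, rfl⟩ := Submodule.mkQ_surjective _ f
    obtain ⟨g, rfl⟩ := Submodule.mkQ_surjective _ g
    obtain ⟨h, rfl⟩ := Submodule.mkQ_surjective _ h
    exact congrArg (Submodule.mkQ _) (P.assoc_in_mid (by assumption) (by assumption) (by assumption)
      (by assumption) (by assumption) (by assumption) (by assumption) (by assumption)
      (by assumption) _ _ _ _ (by assumption) (by assumption) f g h)
  assoc_in_gt := by
    intros
    rename_i f g h
    obtain ⟨f, rfl⟩ := Submodule.mkQ_surjective _ f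
    obtain ⟨g, rfl⟩ := Submodule.mkQ_surjective _ g
    obtain ⟨h, rfl⟩ := Submodule.mkQ_surjective _ h
    exact congrArg (Submodule.mkQ _) (P.assoc_in_gt (by assumption) (by assumption) (by assumption)
      (by assumption) (by assumption) (by assumption) (by assumption) (by assumption)
      (by assumption) _ _ _ _ (by assumption) f g h)
  assoc_out_lt := by
    intros
    rename_i f g h
    obtain ⟨f, rfl⟩ := Submodule.mkQ_surjective _ f
    obtain ⟨g, rfl⟩ := Submodule.mkQ_surjective _ g
    obtain ⟨h, rfl⟩ := Submodule.mkQ_surjective _ h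
    exact congrArg (Submodule.mkQ _) (P.assoc_out_lt (by assumption) (by assumption) (by assumption)
      (by assumption) (by assumption) (by assumption) (by assumption) (by assumption)
      (by assumption) _ _ _ _ (by assumption) f g h)
  assoc_out_mid := by
    intros
    rename_i f g h
    obtain ⟨f, rfl⟩ := Submodule.mkQ_surjective _ f
    obtain ⟨g, rfl⟩ := Submodule.mkQ_surjective _ g
    obtain ⟨h, rfl⟩ := Submodule.mkQ_surjective _ h
    exact congrArg (Submodule.mkQ _) (P.assoc_out_mid (by assumption) (by assumption)
      (by assumption) (by assumption) (by assumption) (by assumption) (by assumption)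
      (by assumption) (by assumption) _ _ _ _ (by assumption) (by assumption) f g h)
  assoc_out_gt := by
    intros
    rename_i f g h
    obtain ⟨f, rfl⟩ := Submodule.mkQ_surjective _ f
    obtain ⟨g, rfl⟩ := Submodule.mkQ_surjective _ g
    obtain ⟨h, rfl⟩ := Submodule.mkQ_surjective _ h
    exact congrArg (Submodule.mkQ _) (P.assoc_out_gt (by assumption) (by assumption) (by assumption)
      (by assumption) (by assumption) (by assumption) (by assumption) (by assumption)
      (by assumption) _ _ _ _ (by assumption) f g h)
  comp_act hm hn hp i j π₁ σ₁ π₂ σ₂ f g := by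
    obtain ⟨f, rfl⟩ := Submodule.mkQ_surjective _ f
    obtain ⟨g, rfl⟩ := Submodule.mkQ_surjective _ g
    exact congrArg (Submodule.mkQ _) (P.comp_act hm hn hp i j π₁ σ₁ π₂ σ₂ f g)

/-- Formal expressions in the generators `E`: linear combinations, permutation actions and
compositions. -/
inductive FreeTerm {k : Type u} [Field k] (E : SBimodule k) : ℕ → ℕ → ℤ → Type u
  | gen {m n : ℕ} {p : ℤ} (x : E.obj m n p) : FreeTerm E m n p
  | zero {m n : ℕ} {p : ℤ} : FreeTerm E m n p
  | add {m n : ℕ} {p : ℤ} (s t : FreeTerm E m n p) : FreeTerm E m n p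
  | smul {m n : ℕ} {p : ℤ} (c : k) (t : FreeTerm E m n p) : FreeTerm E m n p
  | act {m n : ℕ} {p : ℤ} (π : Equiv.Perm (Fin m)) (σ : Equiv.Perm (Fin n))
      (t : FreeTerm E m n p) : FreeTerm E m n p
  | comp {m₁ n₁ m₂ n₂ m n : ℕ} {p₁ p₂ p : ℤ} (hm : m + 1 = m₁ + m₂) (hn : n + 1 = n₁ + n₂)
      (hp : p₁ + p₂ = p) (i : Fin n₁) (j : Fin m₂)
      (s : FreeTerm E m₁ n₁ p₁) (t : FreeTerm E m₂ n₂ p₂) : FreeTerm E m n p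

/-- The value of a formal expression in a dioperad, given values of the generators. -/
def FreeTerm.eval {k : Type u} [Field k] {E : SBimodule k} {P : Dioperad k}
    (φ : SBimoduleHom E P.toSBimodule) :
    ∀ {m n : ℕ} {p : ℤ}, FreeTerm E m n p → P.obj m n p
  | _, _, _, .gen x => φ.map x
  | _, _, _, .zero => 0
  | _, _, _, .add s t => s.eval φ + t.eval φ
  | _, _, _, .smul c t => c • t.eval φ
  | _, _, _, .act π σ t => P.act π σ (t.eval φ)
  | _, _, _, .comp hm hn hp i j s t => P.comp hm hn hp i j (s.eval φ) (t.eval φ)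

/-- Two formal expressions are identified if they have the same value in every dioperad, that is, if
they are equal as a consequence of the axioms of a dioperad and of the relations in `E`. -/
def freeSetoid {k : Type u} [Field k] (E : SBimodule k) (m n : ℕ) (p : ℤ) :
    Setoid (FreeTerm E m n p) where
  r s t := ∀ (P : Dioperad k) (φ : SBimoduleHom E P.toSBimodule), s.eval φ = t.eval φ
  iseqv := ⟨fun _ _ _ => rfl, fun h P φ => (h P φ).symm, fun h h' P φ => (h P φ).trans (h' P φ)⟩

/-- The space of operations of the free dioperad. -/
def FreeObj {k : Type u} [Field k] (E : SBimodule k) (m n : ℕ) (p : ℤ) : Type u :=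
  Quotient (freeSetoid E m n p)

instance FreeObj.instZero {k : Type u} [Field k] (E : SBimodule k) (m n : ℕ) (p : ℤ) :
    Zero (FreeObj E m n p) where
  zero := Quotient.mk _ .zero

instance FreeObj.instAdd {k : Type u} [Field k] (E : SBimodule k) (m n : ℕ) (p : ℤ) :
    Add (FreeObj E m n p) where
  add := Quotient.map₂ .add (fun _ _ h _ _ h' P φ => by
    simp only [FreeTerm.eval, h P φ, h' P φ])

instance FreeObj.instNeg {k : Type u} [Field k] (E : SBimodule k) (m n : ℕ) (p : ℤ) :
    Neg (FreeObj E m n p) where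
  neg := Quotient.map (.smul (-1)) (fun _ _ h P φ => by simp only [FreeTerm.eval, h P φ])

instance FreeObj.instAddCommGroup {k : Type u} [Field k] (E : SBimodule k) (m n : ℕ) (p : ℤ) :
    AddCommGroup (FreeObj E m n p) where
  nsmul := nsmulRec
  zsmul := zsmulRec
  add_assoc := by
    rintro ⟨x⟩ ⟨y⟩ ⟨z⟩
    exact Quotient.sound fun P φ => add_assoc _ _ _
  zero_add := by
    rintro ⟨x⟩
    exact Quotient.sound fun P φ => zero_add _
  add_zero := by
    rintro ⟨x⟩
    exact Quotient.sound fun P φ => add_zero _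
  neg_add_cancel := by
    rintro ⟨x⟩
    exact Quotient.sound fun P φ => by simp [FreeTerm.eval]
  add_comm := by
    rintro ⟨x⟩ ⟨y⟩
    exact Quotient.sound fun P φ => add_comm _ _

instance FreeObj.instModule {k : Type u} [Field k] (E : SBimodule k) (m n : ℕ) (p : ℤ) :
    Module k (FreeObj E m n p) where
  smul c := Quotient.map (.smul c) (fun _ _ h P φ => by simp only [FreeTerm.eval, h P φ])
  one_smul := by
    rintro ⟨x⟩
    exact Quotient.sound fun P φ => one_smul _ _
  mul_smul := by
    rintro a b ⟨x⟩
    exact Quotient.sound fun P φ => mul_smul _ _ _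
  smul_zero := by
    intro a
    exact Quotient.sound fun P φ => smul_zero _
  smul_add := by
    rintro a ⟨x⟩ ⟨y⟩
    exact Quotient.sound fun P φ => smul_add _ _ _
  add_smul := by
    rintro a b ⟨x⟩
    exact Quotient.sound fun P φ => add_smul _ _ _
  zero_smul := by
    rintro ⟨x⟩
    exact Quotient.sound fun P φ => zero_smul _ _

/-- The free dioperad `F₀(E)`. By `freeLift` and `freeLift_unique` below, it has the universal
property of the free dioperad generated by `E`. -/
def freeDioperad {k : Type u} [Field k] (E : SBimodule k) : Dioperad k where
  obj := FreeObj E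
  act π σ :=
    { toFun := Quotient.map (.act π σ) (fun _ _ h P φ => by simp only [FreeTerm.eval, h P φ])
      map_add' := by
        rintro ⟨x⟩ ⟨y⟩
        exact Quotient.sound fun P φ => map_add _ _ _
      map_smul' := by
        rintro c ⟨x⟩
        exact Quotient.sound fun P φ => map_smul _ _ _ }
  act_one := by
    rintro _ _ _ ⟨x⟩
    exact Quotient.sound fun P φ => P.act_one _
  act_mul := by
    rintro _ _ _ π π' σ σ' ⟨x⟩
    exact Quotient.sound fun P φ => P.act_mul _ _ _ _ _
  eq_zero_of_not_inJ0 := by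
    rintro _ _ _ h ⟨x⟩
    exact Quotient.sound fun P φ => P.eq_zero_of_not_inJ0 h _
  comp hm hn hp i j := LinearMap.mk₂ k
    (Quotient.map₂ (.comp hm hn hp i j) (fun _ _ h _ _ h' P φ => by
      simp only [FreeTerm.eval, h P φ, h' P φ]))
    (by
      rintro ⟨x⟩ ⟨y⟩ ⟨z⟩
      exact Quotient.sound fun P φ => LinearMap.map_add₂ _ _ _ _)
    (by
      rintro c ⟨x⟩ ⟨y⟩
      exact Quotient.sound fun P φ => LinearMap.map_smul₂ _ _ _ _)
    (by
      rintro ⟨x⟩ ⟨y⟩ ⟨z⟩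
      exact Quotient.sound fun P φ => map_add _ _ _)
    (by
      rintro c ⟨x⟩ ⟨y⟩
      exact Quotient.sound fun P φ => map_smul _ _ _)
  assoc_in_lt := by
    intro _ _ _ _ _ _ _ _ _ _ _ _ _ _ _ _ _ _ h₁ h₂ h₃ h₄ h₅ h₆ h₇ h₈ h₉ i j κ l hi
    rintro ⟨f⟩ ⟨g⟩ ⟨h⟩
    exact Quotient.sound fun P φ =>
      P.assoc_in_lt h₁ h₂ h₃ h₄ h₅ h₆ h₇ h₈ h₉ i j κ l hi _ _ _
  assoc_in_mid := by
    intro _ _ _ _ _ _ _ _ _ _ _ _ _ _ _ _ _ _ h₁ h₂ h₃ h₄ h₅ h₆ h₇ h₈ h₉ i j κ l hi hi'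
    rintro ⟨f⟩ ⟨g⟩ ⟨h⟩
    exact Quotient.sound fun P φ =>
      P.assoc_in_mid h₁ h₂ h₃ h₄ h₅ h₆ h₇ h₈ h₉ i j κ l hi hi' _ _ _
  assoc_in_gt := by
    intro _ _ _ _ _ _ _ _ _ _ _ _ _ _ _ _ _ _ h₁ h₂ h₃ h₄ h₅ h₆ h₇ h₈ h₉ i j κ l hi
    rintro ⟨f⟩ ⟨g⟩ ⟨h⟩
    exact Quotient.sound fun P φ =>
      P.assoc_in_gt h₁ h₂ h₃ h₄ h₅ h₆ h₇ h₈ h₉ i j κ l hi _ _ _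
  assoc_out_lt := by
    intro _ _ _ _ _ _ _ _ _ _ _ _ _ _ _ _ _ _ h₁ h₂ h₃ h₄ h₅ h₆ h₇ h₈ h₉ i j κ l hi
    rintro ⟨f⟩ ⟨g⟩ ⟨h⟩
    exact Quotient.sound fun P φ =>
      P.assoc_out_lt h₁ h₂ h₃ h₄ h₅ h₆ h₇ h₈ h₉ i j κ l hi _ _ _
  assoc_out_mid := by
    intro _ _ _ _ _ _ _ _ _ _ _ _ _ _ _ _ _ _ h₁ h₂ h₃ h₄ h₅ h₆ h₇ h₈ h₉ i j κ l hi hi'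
    rintro ⟨f⟩ ⟨g⟩ ⟨h⟩
    exact Quotient.sound fun P φ =>
      P.assoc_out_mid h₁ h₂ h₃ h₄ h₅ h₆ h₇ h₈ h₉ i j κ l hi hi' _ _ _
  assoc_out_gt := by
    intro _ _ _ _ _ _ _ _ _ _ _ _ _ _ _ _ _ _ h₁ h₂ h₃ h₄ h₅ h₆ h₇ h₈ h₉ i j κ l hi
    rintro ⟨f⟩ ⟨g⟩ ⟨h⟩
    exact Quotient.sound fun P φ =>
      P.assoc_out_gt h₁ h₂ h₃ h₄ h₅ h₆ h₇ h₈ h₉ i j κ l hi _ _ _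
  comp_act := by
    intro _ _ _ _ _ _ _ _ _ hm hn hp i j π₁ σ₁ π₂ σ₂
    rintro ⟨f⟩ ⟨g⟩
    exact Quotient.sound fun P φ => P.comp_act hm hn hp i j π₁ σ₁ π₂ σ₂ _ _

/-- The inclusion of the generators into the free dioperad. -/
def freeGen {k : Type u} [Field k] (E : SBimodule k) :
    SBimoduleHom E (freeDioperad E).toSBimodule where
  map :=
    { toFun := fun x => Quotient.mk _ (.gen x)
      map_add' := fun _ _ => Quotient.sound fun _ φ => map_add φ.map _ _
      map_smul' := fun _ _ => Quotient.sound fun _ φ => map_smul φ.map _ _ }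
  map_act π σ x := Quotient.sound fun _ φ => φ.map_act π σ x

/-- A morphism of dioperads. -/
structure DioperadHom {k : Type u} [Field k] (P Q : Dioperad k) extends
    SBimoduleHom P.toSBimodule Q.toSBimodule where
  map_comp : ∀ {m₁ n₁ m₂ n₂ m n : ℕ} {p₁ p₂ p : ℤ}
    (hm : m + 1 = m₁ + m₂) (hn : n + 1 = n₁ + n₂) (hp : p₁ + p₂ = p) (i : Fin n₁) (j : Fin m₂)
    (f : P.obj m₁ n₁ p₁) (g : P.obj m₂ n₂ p₂),
    map (P.comp hm hn hp i j f g) = Q.comp hm hn hp i j (map f) (map g)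

/-- Every morphism of collections from `E` to a dioperad extends to the free dioperad. -/
def freeLift {k : Type u} [Field k] {E : SBimodule k} {P : Dioperad k}
    (φ : SBimoduleHom E P.toSBimodule) : DioperadHom (freeDioperad E) P where
  map :=
    { toFun := Quotient.lift (fun t => t.eval φ) (fun _ _ h => h P φ)
      map_add' := by
        rintro ⟨x⟩ ⟨y⟩
        rfl
      map_smul' := by
        rintro c ⟨x⟩
        rfl }
  map_act π σ x := by
    obtain ⟨x⟩ := x
    rfl
  map_comp hm hn hp i j f g := by
    obtain ⟨f⟩ := f
    obtain ⟨g⟩ := g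
    rfl

theorem freeLift_gen {k : Type u} [Field k] {E : SBimodule k} {P : Dioperad k}
    (φ : SBimoduleHom E P.toSBimodule) {m n : ℕ} {p : ℤ} (x : E.obj m n p) :
    (freeLift φ).map ((freeGen E).map x) = φ.map x := rfl

theorem freeLift_unique_aux {k : Type u} [Field k] {E : SBimodule k} {P : Dioperad k}
    (φ : SBimoduleHom E P.toSBimodule) (F : DioperadHom (freeDioperad E) P)
    (hF : ∀ {m n : ℕ} {p : ℤ} (x : E.obj m n p), F.map ((freeGen E).map x) = φ.map x)
    {m n : ℕ} {p : ℤ} (t : FreeTerm E m n p) :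
    F.map (show (freeDioperad E).obj m n p from Quotient.mk (freeSetoid E m n p) t) =
      t.eval φ := by
  induction t with
  | gen x => exact hF x
  | zero => exact map_zero F.map
  | add s t hs ht => exact (map_add F.map _ _).trans (congrArg₂ _ hs ht)
  | smul c t ht => exact (map_smul F.map c _).trans (congrArg _ ht)
  | act π σ t ht => exact (F.map_act π σ _).trans (congrArg _ ht)
  | comp hm hn hp i j s t hs ht =>
    exact (F.map_comp hm hn hp i j _ _).trans
      (congrArg₂ (fun x y => P.comp hm hn hp i j x y) hs ht)

/-- The extension to the free dioperad is unique. -/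
theorem freeLift_unique {k : Type u} [Field k] {E : SBimodule k} {P : Dioperad k}
    (φ : SBimoduleHom E P.toSBimodule) (F : DioperadHom (freeDioperad E) P)
    (hF : ∀ {m n : ℕ} {p : ℤ} (x : E.obj m n p), F.map ((freeGen E).map x) = φ.map x)
    {m n : ℕ} {p : ℤ} (t : (freeDioperad E).obj m n p) : F.map t = (freeLift φ).map t :=
  Quotient.ind (motive := fun t : (freeDioperad E).obj m n p => F.map t = (freeLift φ).map t)
    (freeLift_unique_aux φ F hF) t

/-- The composition `f ᵢ∘₁ g` of two operations of arity `(1,2)`. -/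
abbrev Dioperad.comp13 {k : Type u} [Field k] (P : Dioperad k) {p₁ p₂ p : ℤ} (hp : p₁ + p₂ = p)
    (i : Fin 2) : P.obj 1 2 p₁ →ₗ[k] P.obj 1 2 p₂ →ₗ[k] P.obj 1 3 p :=
  P.comp (m₁ := 1) (n₁ := 2) (m₂ := 1) (n₂ := 2) (m := 1) (n := 3) rfl rfl hp i 0

/-- The composition `f ᵢ∘ⱼ g` of operations of arities `(1,2)` and `(2,0)`. -/
abbrev Dioperad.comp21 {k : Type u} [Field k] (P : Dioperad k) {p₁ p₂ p : ℤ} (hp : p₁ + p₂ = p)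
    (i : Fin 2) (j : Fin 2) : P.obj 1 2 p₁ →ₗ[k] P.obj 2 0 p₂ →ₗ[k] P.obj 2 1 p :=
  P.comp (m₁ := 1) (n₁ := 2) (m₂ := 2) (n₂ := 0) (m := 2) (n := 1) rfl rfl hp i j

/-- The pairs of degrees with sum `p`. -/
structure DegPair (p : ℤ) where
  fst : ℤ
  snd : ℤ
  add_eq : fst + snd = p

instance DegPair.instDecidableEq (p : ℤ) : DecidableEq (DegPair p) := fun x y =>
  decidable_of_iff (x.fst = y.fst ∧ x.snd = y.snd) (by cases x; cases y; simp)

/-- Negation of degrees. -/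
def DegPair.neg {p : ℤ} (ab : DegPair p) : DegPair (-p) :=
  ⟨-ab.fst, -ab.snd, by have := ab.add_eq; omega⟩

/-- The summand of bidegree `(a,b)` of the graded tensor product `E(m₁,n₁) ⊗ E(m₂,n₂)`. -/
abbrev SBimodule.TensComp {k : Type u} [Field k] (E : SBimodule k) (m₁ n₁ m₂ n₂ : ℕ) (a b : ℤ) :
    Type u :=
  E.obj m₁ n₁ a ⊗[k] E.obj m₂ n₂ b

/-- The degree `p` part of the graded tensor product `E(m₁,n₁) ⊗ E(m₂,n₂)`. -/
def SBimodule.Tens {k : Type u} [Field k] (E : SBimodule k) (m₁ n₁ m₂ n₂ : ℕ) (p : ℤ) : Type u :=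
  ⨁ ab : DegPair p, E.TensComp m₁ n₁ m₂ n₂ ab.fst ab.snd

instance SBimodule.instAddCommGroupTens {k : Type u} [Field k] (E : SBimodule k)
    (m₁ n₁ m₂ n₂ : ℕ) (p : ℤ) : AddCommGroup (E.Tens m₁ n₁ m₂ n₂ p) :=
  inferInstanceAs (AddCommGroup (⨁ ab : DegPair p, E.TensComp m₁ n₁ m₂ n₂ ab.fst ab.snd))

instance SBimodule.instModuleTens {k : Type u} [Field k] (E : SBimodule k)
    (m₁ n₁ m₂ n₂ : ℕ) (p : ℤ) : Module k (E.Tens m₁ n₁ m₂ n₂ p) :=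
  inferInstanceAs (Module k (⨁ ab : DegPair p, E.TensComp m₁ n₁ m₂ n₂ ab.fst ab.snd))

/-- The inclusion of the summand of bidegree `ab`. -/
def SBimodule.tensIncl {k : Type u} [Field k] (E : SBimodule k) (m₁ n₁ m₂ n₂ : ℕ) {p : ℤ}
    (ab : DegPair p) : E.TensComp m₁ n₁ m₂ n₂ ab.fst ab.snd →ₗ[k] E.Tens m₁ n₁ m₂ n₂ p :=
  DirectSum.lof k (DegPair p) (fun ab => E.TensComp m₁ n₁ m₂ n₂ ab.fst ab.snd) ab

/-- The projection to the summand of bidegree `ab`. -/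
def SBimodule.tensProj {k : Type u} [Field k] (E : SBimodule k) (m₁ n₁ m₂ n₂ : ℕ) {p : ℤ}
    (ab : DegPair p) : E.Tens m₁ n₁ m₂ n₂ p →ₗ[k] E.TensComp m₁ n₁ m₂ n₂ ab.fst ab.snd :=
  DirectSum.component k (DegPair p) (fun ab => E.TensComp m₁ n₁ m₂ n₂ ab.fst ab.snd) ab

/-- The linear map on the direct sum with given values on the summands. -/
def SBimodule.tensLift {k : Type u} [Field k] (E : SBimodule k) {m₁ n₁ m₂ n₂ : ℕ} {p : ℤ}
    {M : Type u} [AddCommGroup M] [Module k M]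
    (F : ∀ ab : DegPair p, E.TensComp m₁ n₁ m₂ n₂ ab.fst ab.snd →ₗ[k] M) :
    E.Tens m₁ n₁ m₂ n₂ p →ₗ[k] M :=
  DirectSum.toModule k (DegPair p) M F

theorem SBimodule.tensLift_incl {k : Type u} [Field k] (E : SBimodule k) {m₁ n₁ m₂ n₂ : ℕ} {p : ℤ}
    {M : Type u} [AddCommGroup M] [Module k M]
    (F : ∀ ab : DegPair p, E.TensComp m₁ n₁ m₂ n₂ ab.fst ab.snd →ₗ[k] M) (ab : DegPair p)
    (t : E.TensComp m₁ n₁ m₂ n₂ ab.fst ab.snd) :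
    E.tensLift F (E.tensIncl m₁ n₁ m₂ n₂ ab t) = F ab t :=
  DirectSum.toModule_lof (M := fun ab : DegPair p => E.TensComp m₁ n₁ m₂ n₂ ab.fst ab.snd)
    (φ := F) k ab t

theorem SBimodule.tensProj_incl {k : Type u} [Field k] (E : SBimodule k) {m₁ n₁ m₂ n₂ : ℕ} {p : ℤ}
    (ab : DegPair p) (t : E.TensComp m₁ n₁ m₂ n₂ ab.fst ab.snd) :
    E.tensProj m₁ n₁ m₂ n₂ ab (E.tensIncl m₁ n₁ m₂ n₂ ab t) = t :=
  DirectSum.component.lof_self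
    (M := fun ab : DegPair p => E.TensComp m₁ n₁ m₂ n₂ ab.fst ab.snd) k ab t

/-- The element `f ⊗ g` of the graded tensor product. -/
def SBimodule.tens {k : Type u} [Field k] (E : SBimodule k) {m₁ n₁ m₂ n₂ : ℕ} {p₁ p₂ p : ℤ}
    (hp : p₁ + p₂ = p) (f : E.obj m₁ n₁ p₁) (g : E.obj m₂ n₂ p₂) : E.Tens m₁ n₁ m₂ n₂ p :=
  E.tensIncl m₁ n₁ m₂ n₂ ⟨p₁, p₂, hp⟩ (f ⊗ₜ[k] g)

/-- The right action `f ⊗ g ↦ f ⊗ g h` on the second tensor factor. -/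
def SBimodule.tensAct {k : Type u} [Field k] (E : SBimodule k) {m₁ n₁ m₂ n₂ : ℕ} {p : ℤ}
    (h : Equiv.Perm (Fin n₂)) : E.Tens m₁ n₁ m₂ n₂ p →ₗ[k] E.Tens m₁ n₁ m₂ n₂ p :=
  E.tensLift (fun ab => E.tensIncl m₁ n₁ m₂ n₂ ab ∘ₗ TensorProduct.map LinearMap.id (E.act 1 h))

/-- The composition `f ⊗ g ↦ f ₁∘₁ g` of two generators of arity `(1,2)` in the free dioperad. -/
def SBimodule.tensComp13 {k : Type u} [Field k] (E : SBimodule k) {p : ℤ} :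
    E.Tens 1 2 1 2 p →ₗ[k] (freeDioperad E).obj 1 3 p :=
  E.tensLift (fun ab => TensorProduct.lift
    (((freeDioperad E).comp13 ab.add_eq 0).compl₁₂ (freeGen E).map (freeGen E).map))

/-- The composition `f ⊗ g ↦ f ₁∘₁ g` of generators of arities `(1,2)` and `(2,0)` in the free
dioperad. -/
def SBimodule.tensComp21 {k : Type u} [Field k] (E : SBimodule k) {p : ℤ} :
    E.Tens 1 2 2 0 p →ₗ[k] (freeDioperad E).obj 2 1 p :=
  E.tensLift (fun ab => TensorProduct.lift
    (((freeDioperad E).comp21 ab.add_eq 0 0).compl₁₂ (freeGen E).map (freeGen E).map))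

theorem SBimodule.tensAct_tens {k : Type u} [Field k] (E : SBimodule k) {m₁ n₁ m₂ n₂ : ℕ}
    {p₁ p₂ p : ℤ} (hp : p₁ + p₂ = p) (f : E.obj m₁ n₁ p₁) (g : E.obj m₂ n₂ p₂)
    (h : Equiv.Perm (Fin n₂)) :
    E.tensAct h (E.tens hp f g) = E.tens hp f (E.act 1 h g) := by
  rw [SBimodule.tensAct, SBimodule.tens, SBimodule.tensLift_incl]
  rfl

theorem SBimodule.tensComp13_tens {k : Type u} [Field k] (E : SBimodule k) {p₁ p₂ p : ℤ}
    (hp : p₁ + p₂ = p) (f : E.obj 1 2 p₁) (g : E.obj 1 2 p₂) :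
    E.tensComp13 (E.tens hp f g) =
      (freeDioperad E).comp13 hp 0 ((freeGen E).map f) ((freeGen E).map g) := by
  rw [SBimodule.tensComp13, SBimodule.tens, SBimodule.tensLift_incl]
  rfl

theorem SBimodule.tensComp21_tens {k : Type u} [Field k] (E : SBimodule k) {p₁ p₂ p : ℤ}
    (hp : p₁ + p₂ = p) (f : E.obj 1 2 p₁) (g : E.obj 2 0 p₂) :
    E.tensComp21 (E.tens hp f g) =
      (freeDioperad E).comp21 hp 0 0 ((freeGen E).map f) ((freeGen E).map g) := by
  rw [SBimodule.tensComp21, SBimodule.tens, SBimodule.tensLift_incl]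
  rfl

/-- The inclusion `S₂ → S₃` acting on the first two letters. -/
def upperPerm (h : Equiv.Perm (Fin 2)) : Equiv.Perm (Fin 3) :=
  permComp (a := 2) (b := 2) (c := 3) rfl 1 0 h

theorem upperPerm_mul : ∀ h h' : Equiv.Perm (Fin 2),
    upperPerm (h * h') = upperPerm h * upperPerm h' := by decide

theorem upperPerm_injective : Function.Injective upperPerm := by
  unfold Function.Injective; decide

/-- The space `F₀(E)(1,3) = Ind_{S₂}^{S₃} (E(1,2) ⊗ E(1,2))` of trees with two vertices, in degree
`p`. An element of the induced module is a function `w` on `S₃` which is equivariant under `S₂`;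
it stands for the sum of `(f ₁∘₁ g) σ` over representatives `σ` of `S₂ \ S₃`, where `w σ = f ⊗ g`. -/
def Ind13 {k : Type u} [Field k] (E : SBimodule k) (p : ℤ) :
    Submodule k (Equiv.Perm (Fin 3) → E.Tens 1 2 1 2 p) where
  carrier := {w | ∀ h σ, w (upperPerm h * σ) = E.tensAct h⁻¹ (w σ)}
  add_mem' := by
    intro v w hv hw h σ
    simp only [Pi.add_apply, map_add, hv h σ, hw h σ]
  zero_mem' := by
    intro h σ
    simp only [Pi.zero_apply, map_zero]
  smul_mem' := by
    intro c w hw h σ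
    simp only [Pi.smul_apply, map_smul, hw h σ]

/-- The right action of `S₃`. -/
def Ind13.act {k : Type u} [Field k] {E : SBimodule k} {p : ℤ} (σ : Equiv.Perm (Fin 3)) :
    Ind13 E p →ₗ[k] Ind13 E p where
  toFun w := ⟨fun τ => w.1 (τ * σ⁻¹), fun h τ => by
    simp only [mul_assoc]; exact w.2 h _⟩
  map_add' _ _ := rfl
  map_smul' _ _ := rfl

/-- The tree `(f ₁∘₁ g) σ`. -/
def Ind13.tree {k : Type u} [Field k] {E : SBimodule k} {p₁ p₂ p : ℤ} (hp : p₁ + p₂ = p)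
    (f : E.obj 1 2 p₁) (g : E.obj 1 2 p₂) (σ : Equiv.Perm (Fin 3)) : Ind13 E p :=
  ⟨fun τ => ∑ h : Equiv.Perm (Fin 2),
      if τ = upperPerm h * σ then E.tens hp f (E.act 1 h⁻¹ g) else 0, by
    intro h₀ τ
    rw [map_sum]
    refine (Equiv.sum_comp (Equiv.mulLeft h₀) _).symm.trans (Finset.sum_congr rfl fun h _ => ?_)
    have h2 : (upperPerm h₀ * τ = upperPerm (h₀ * h) * σ) ↔ (τ = upperPerm h * σ) := by
      rw [upperPerm_mul, mul_assoc, mul_right_inj]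
    change (if upperPerm h₀ * τ = upperPerm (h₀ * h) * σ then
      E.tens hp f (E.act 1 (h₀ * h)⁻¹ g) else 0) = _
    by_cases h1 : τ = upperPerm h * σ
    · rw [if_pos (h2.2 h1), if_pos h1, E.tensAct_tens, ← E.act_mul, mul_inv_rev, one_mul]
    · rw [if_neg (fun h3 => h1 (h2.1 h3)), if_neg h1, map_zero]⟩

/-- The identification of `Ind_{S₂}^{S₃} (E(1,2) ⊗ E(1,2))` with trees in the free dioperad. Summing
over `S₃` counts every coset of `S₂` twice. -/
def Ind13.toFree {k : Type u} [Field k] {E : SBimodule k} {p : ℤ} :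
    Ind13 E p →ₗ[k] (freeDioperad E).obj 1 3 p :=
  (2 : k)⁻¹ • ∑ σ : Equiv.Perm (Fin 3),
    (freeDioperad E).act 1 σ ∘ₗ E.tensComp13 ∘ₗ LinearMap.proj σ ∘ₗ (Ind13 E p).subtype

/-- The space `F₀(E)(2,1) = Ind_{1}^{S₂} (E(1,2) ⊗ E(2,0))` of trees with two vertices, in degree
`p`. A function `w` on `S₂` stands for the sum of `π (f ₁∘₁ g)` over `π`, where `w π = f ⊗ g`. -/
abbrev Ind21 {k : Type u} [Field k] (E : SBimodule k) (p : ℤ) : Type u :=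
  Equiv.Perm (Fin 2) → E.Tens 1 2 2 0 p

/-- The left action of `S₂`. -/
def Ind21.act {k : Type u} [Field k] {E : SBimodule k} {p : ℤ} (π : Equiv.Perm (Fin 2)) :
    Ind21 E p →ₗ[k] Ind21 E p :=
  LinearMap.funLeft k _ (fun τ => π⁻¹ * τ)

/-- The tree `π (f ₁∘₁ g)`. -/
def Ind21.tree {k : Type u} [Field k] {E : SBimodule k} {p₁ p₂ p : ℤ} (hp : p₁ + p₂ = p)
    (f : E.obj 1 2 p₁) (g : E.obj 2 0 p₂) (π : Equiv.Perm (Fin 2)) : Ind21 E p :=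
  Pi.single π (E.tens hp f g)

/-- The identification of `Ind_{1}^{S₂} (E(1,2) ⊗ E(2,0))` with trees in the free dioperad. -/
def Ind21.toFree {k : Type u} [Field k] {E : SBimodule k} {p : ℤ} :
    Ind21 E p →ₗ[k] (freeDioperad E).obj 2 1 p :=
  ∑ π : Equiv.Perm (Fin 2),
    (freeDioperad E).act π 1 ∘ₗ E.tensComp21 ∘ₗ LinearMap.proj π

/-- The tree `(f ₁∘₁ g) σ` is the element of the free dioperad with this name. -/
theorem Ind13.toFree_tree {k : Type u} [Field k] [CharZero k] {E : SBimodule k} {p₁ p₂ p : ℤ}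
    (hp : p₁ + p₂ = p) (f : E.obj 1 2 p₁) (g : E.obj 1 2 p₂) (σ : Equiv.Perm (Fin 3)) :
    Ind13.toFree (Ind13.tree hp f g σ) =
      (freeDioperad E).act 1 σ
        ((freeDioperad E).comp13 hp 0 ((freeGen E).map f) ((freeGen E).map g)) := by
  have key : ∀ h : Equiv.Perm (Fin 2),
      (freeDioperad E).act 1 (upperPerm h * σ)
        (E.tensComp13 (E.tens hp f (E.act 1 h⁻¹ g))) =
      (freeDioperad E).act 1 σ
        ((freeDioperad E).comp13 hp 0 ((freeGen E).map f) ((freeGen E).map g)) := by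
    intro h
    have h1 := (freeDioperad E).act_mul 1 1 σ (upperPerm h)
      (E.tensComp13 (E.tens hp f (E.act 1 h⁻¹ g)))
    rw [one_mul] at h1
    rw [h1, E.tensComp13_tens, (freeGen E).map_act]
    congr 1
    have h2 := (freeDioperad E).comp_act (m₁ := 1) (n₁ := 2) (m₂ := 1) (n₂ := 2)
      (m := 1) (n := 3) rfl rfl hp 0 0 1 1 1 h
      ((freeGen E).map f) ((freeDioperad E).act 1 h⁻¹ ((freeGen E).map g))
    rw [(freeDioperad E).act_one, ← (freeDioperad E).act_mul, inv_mul_cancel, one_mul,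
      (freeDioperad E).act_one] at h2
    have h3 : permComp (a := 1) (b := 1) (c := 1) (by omega) 1 ((1 : Equiv.Perm (Fin 1))⁻¹ 0) 1
      = 1 := Subsingleton.elim _ _
    rw [h3] at h2
    exact h2.symm
  simp only [Ind13.toFree, Ind13.tree, LinearMap.smul_apply, LinearMap.sum_apply,
    LinearMap.comp_apply, LinearMap.proj_apply, Submodule.subtype_apply, map_sum]
  rw [Finset.sum_comm]
  have h4 : ∀ h : Equiv.Perm (Fin 2), (∑ τ : Equiv.Perm (Fin 3),
      (freeDioperad E).act 1 τ (E.tensComp13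
        (if τ = upperPerm h * σ then E.tens hp f (E.act 1 h⁻¹ g) else 0))) =
      (freeDioperad E).act 1 σ
        ((freeDioperad E).comp13 hp 0 ((freeGen E).map f) ((freeGen E).map g)) := by
    intro h
    rw [Finset.sum_eq_single (upperPerm h * σ)]
    · rw [if_pos rfl, key h]
    · intro τ _ hτ
      rw [if_neg hτ, map_zero, map_zero]
    · intro hn
      exact absurd (Finset.mem_univ _) hn
  simp only [h4, Finset.sum_const, Finset.card_univ, Fintype.card_perm, Fintype.card_fin,
    Nat.factorial_two]
  rw [← Nat.cast_smul_eq_nsmul k, smul_smul]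
  simp

theorem Ind21.toFree_tree {k : Type u} [Field k] {E : SBimodule k} {p₁ p₂ p : ℤ}
    (hp : p₁ + p₂ = p) (f : E.obj 1 2 p₁) (g : E.obj 2 0 p₂) (π : Equiv.Perm (Fin 2)) :
    Ind21.toFree (Ind21.tree hp f g π) =
      (freeDioperad E).act π 1
        ((freeDioperad E).comp21 hp 0 0 ((freeGen E).map f) ((freeGen E).map g)) := by
  simp only [Ind21.toFree, Ind21.tree, LinearMap.sum_apply, LinearMap.comp_apply,
    LinearMap.proj_apply]
  rw [Finset.sum_eq_single π]
  · rw [Pi.single_eq_same, E.tensComp21_tens]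
  · intro τ _ hτ
    rw [Pi.single_eq_of_ne hτ, map_zero, map_zero]
  · intro hn
    exact absurd (Finset.mem_univ _) hn

/-- Quadratic data `(E; R)`: generators concentrated in the arities `(1,2)` and `(2,0)`, and graded
relations, a right `S₃`-submodule `R(1,3)` of `F₀(E)(1,3)` and a left `S₂`-submodule `R(2,1)` of
`F₀(E)(2,1)`. -/
structure QuadraticData (k : Type u) [Field k] where
  E : SBimodule k
  eq_zero_of_ne : ∀ {m n : ℕ} {p : ℤ}, (m, n) ≠ (1, 2) → (m, n) ≠ (2, 0) →
    ∀ x : E.obj m n p, x = 0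
  R13 : ∀ p, Submodule k (Ind13 E p)
  R13_act : ∀ {p : ℤ} (σ : Equiv.Perm (Fin 3)) {w : Ind13 E p}, w ∈ R13 p →
    Ind13.act σ w ∈ R13 p
  R21 : ∀ p, Submodule k (Ind21 E p)
  R21_act : ∀ {p : ℤ} (π : Equiv.Perm (Fin 2)) {w : Ind21 E p}, w ∈ R21 p →
    Ind21.act π w ∈ R21 p

/-- The relations, as elements of the free dioperad. -/
inductive QuadraticData.Relations {k : Type u} [Field k] (Q : QuadraticData k) :
    ∀ m n p, (freeDioperad Q.E).obj m n p → Prop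
  | of13 {p : ℤ} (w : Ind13 Q.E p) (hw : w ∈ Q.R13 p) : Relations Q 1 3 p (Ind13.toFree w)
  | of21 {p : ℤ} (w : Ind21 Q.E p) (hw : w ∈ Q.R21 p) : Relations Q 2 1 p (Ind21.toFree w)

/-- The ideal `(R)` of the free dioperad generated by the relations. -/
def QuadraticData.ideal {k : Type u} [Field k] (Q : QuadraticData k) :
    DioperadIdeal (freeDioperad Q.E) :=
  DioperadIdeal.span (fun m n p => {x | Q.Relations m n p x})

/-- The quadratic dioperad `⟨E; R⟩ = F₀(E) / (R)`. -/
def QuadraticData.dioperad {k : Type u} [Field k] (Q : QuadraticData k) : Dioperad k :=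
  (freeDioperad Q.E).quotient Q.ideal

/-- The class of a generator in the quadratic dioperad. -/
def QuadraticData.gen {k : Type u} [Field k] (Q : QuadraticData k) {m n : ℕ} {p : ℤ}
    (x : Q.E.obj m n p) : Q.dioperad.obj m n p :=
  (Q.ideal.carrier m n p).mkQ ((freeGen Q.E).map x)

/-- The bimodules `E(m,n)^* ⊗ Sgn_n`, where `(E^*)^p` is the dual of `E^{-p}` and carries the dual
representation. For `(m,n) = (1,2), (2,0)` this is `E^∨(m,n) = E(m,n)^*[-1] ⊗ Ω(m,n)`: the space
`Ω(m,n)` is concentrated in degree `3 - n - 2m = -1`, which cancels the shift, and `(π,σ)` acts on it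
by `sgn σ`. -/
def SBimodule.dual {k : Type u} [Field k] (E : SBimodule k) : SBimodule k where
  obj m n p := Module.Dual k (E.obj m n (-p))
  act π σ := ((Equiv.Perm.sign σ : ℤ) : k) • (E.act π⁻¹ σ⁻¹).dualMap
  act_one x := by
    ext y
    simp [E.act_one]
  act_mul π π' σ σ' x := by
    ext y
    have h := E.act_mul π'⁻¹ π⁻¹ σ'⁻¹ σ⁻¹ y
    simp only [mul_inv_rev, Equiv.Perm.sign_mul, Units.val_mul, Int.cast_mul,
      LinearMap.smul_apply, LinearMap.dualMap_apply, smul_eq_mul, map_smul, h]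
    ring
  eq_zero_of_not_inJ0 h x := by
    ext y
    rw [E.eq_zero_of_not_inJ0 h y, map_zero, map_zero]

/-- The pairing of `(E^*)^a ⊗ (E^*)^b` with `E^{-a} ⊗ E^{-b}`: the value of `x ⊗ y` on `f ⊗ g` is
`(-1)^{|y||f|} x(f) y(g)`. -/
def SBimodule.pairComp {k : Type u} [Field k] (E : SBimodule k) (m₁ n₁ m₂ n₂ : ℕ) (a b : ℤ) :
    E.dual.TensComp m₁ n₁ m₂ n₂ a b →ₗ[k] Module.Dual k (E.TensComp m₁ n₁ m₂ n₂ (-a) (-b)) :=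
  (-1 : k) ^ (b * -a) • TensorProduct.dualDistrib k (E.obj m₁ n₁ (-a)) (E.obj m₂ n₂ (-b))

/-- The pairing of `E^* ⊗ E^*` with `E ⊗ E`. -/
def SBimodule.pairTens {k : Type u} [Field k] (E : SBimodule k) {m₁ n₁ m₂ n₂ : ℕ} {p : ℤ} :
    E.dual.Tens m₁ n₁ m₂ n₂ p →ₗ[k] Module.Dual k (E.Tens m₁ n₁ m₂ n₂ (-p)) :=
  E.dual.tensLift (fun ab =>
    (E.tensProj m₁ n₁ m₂ n₂ ab.neg).dualMap ∘ₗ E.pairComp m₁ n₁ m₂ n₂ ab.fst ab.snd)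

theorem SBimodule.pairTens_tens {k : Type u} [Field k] (E : SBimodule k) {m₁ n₁ m₂ n₂ : ℕ}
    {p₁ p₂ p : ℤ} (hp : p₁ + p₂ = p) (hp' : -p₁ + -p₂ = -p)
    (x : E.dual.obj m₁ n₁ p₁) (y : E.dual.obj m₂ n₂ p₂)
    (f : E.obj m₁ n₁ (-p₁)) (g : E.obj m₂ n₂ (-p₂)) :
    E.pairTens (E.dual.tens hp x y) (E.tens hp' f g) =
      (-1 : k) ^ (p₂ * -p₁) *
        ((show Module.Dual k (E.obj m₁ n₁ (-p₁)) from x) f *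
          (show Module.Dual k (E.obj m₂ n₂ (-p₂)) from y) g) := by
  have h1 : E.pairTens (E.dual.tens hp x y) = _ :=
    E.dual.tensLift_incl (m₁ := m₁) (n₁ := n₁) (m₂ := m₂) (n₂ := n₂) _ ⟨p₁, p₂, hp⟩ (x ⊗ₜ[k] y)
  rw [h1]
  exact congrArg (E.pairComp m₁ n₁ m₂ n₂ p₁ p₂ (x ⊗ₜ[k] y))
    (E.tensProj_incl (m₁ := m₁) (n₁ := n₁) (m₂ := m₂) (n₂ := n₂) ⟨-p₁, -p₂, hp'⟩ (f ⊗ₜ[k] g))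

/-- The pairing of `F₀(E^∨)(1,3)` with `F₀(E)(1,3)`, through `F₀(E^∨) ≅ F₀(E^*[-1]) ⊗ Ω`. On the tree
`(f ₁∘₁ g) σ` the factor `Ω` contributes `(1 ₁∘₁ 1) σ = sgn σ`; every tree is counted twice. -/
def Ind13.pair {k : Type u} [Field k] {E : SBimodule k} {p : ℤ} (w : Ind13 E.dual p)
    (r : Ind13 E (-p)) : k :=
  ∑ σ : Equiv.Perm (Fin 3), ((Equiv.Perm.sign σ : ℤ) : k) * E.pairTens (w.1 σ) (r.1 σ)

/-- The pairing of `F₀(E^∨)(2,1)` with `F₀(E)(2,1)`, through `F₀(E^∨) ≅ F₀(E^*[-1]) ⊗ Ω`. On the tree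
`π (f ₁∘₁ g)` the factor `Ω` contributes `π (1 ₁∘₁ 1) = 1`. -/
def Ind21.pair {k : Type u} [Field k] {E : SBimodule k} {p : ℤ} (w : Ind21 E.dual p)
    (r : Ind21 E (-p)) : k :=
  ∑ π : Equiv.Perm (Fin 2), E.pairTens (w π) (r π)

/-- The data `(E^∨; R^⊥)` of the quadratic dual, for finite-dimensional generators. -/
def QuadraticData.dual {k : Type u} [Field k] (Q : QuadraticData k) : QuadraticData k where
  E := Q.E.dual
  eq_zero_of_ne h h' x := by
    refine LinearMap.ext (f := (show Module.Dual k _ from x)) fun y => ?_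
    rw [Q.eq_zero_of_ne h h' y]
    exact (map_zero _).trans (map_zero _).symm
  R13 p :=
    { carrier := {w | ∀ r ∈ Q.R13 (-p), Ind13.pair w r = 0}
      add_mem' := by
        intro v w hv hw r hr
        have h1 := hv r hr
        have h2 := hw r hr
        simp only [Ind13.pair] at h1 h2 ⊢
        simp only [Submodule.coe_add, Pi.add_apply, map_add, LinearMap.add_apply, mul_add,
          Finset.sum_add_distrib, h1, h2, add_zero]
      zero_mem' := by
        intro r _
        simp [Ind13.pair]
      smul_mem' := by
        intro c w hw r hr
        have h1 := hw r hr
        simp only [Ind13.pair] at h1 ⊢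
        simp only [Submodule.coe_smul, Pi.smul_apply, map_smul, LinearMap.smul_apply, smul_eq_mul,
          mul_left_comm _ c, ← Finset.mul_sum, h1, mul_zero] }
  R13_act {p} σ w hw := by
    intro r hr
    have h1 := hw _ (Q.R13_act σ⁻¹ hr)
    simp only [Ind13.pair] at h1 ⊢
    rw [← Equiv.sum_comp (Equiv.mulRight σ)]
    have h2 : ∀ τ : Equiv.Perm (Fin 3),
        ((Equiv.Perm.sign (Equiv.mulRight σ τ) : ℤ) : k) *
          Q.E.pairTens ((Ind13.act σ w).1 (Equiv.mulRight σ τ)) (r.1 (Equiv.mulRight σ τ)) =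
        ((Equiv.Perm.sign σ : ℤ) : k) * (((Equiv.Perm.sign τ : ℤ) : k) *
          Q.E.pairTens (w.1 τ) ((Ind13.act σ⁻¹ r).1 τ)) := by
      intro τ
      simp only [Equiv.coe_mulRight, Ind13.act, LinearMap.coe_mk, AddHom.coe_mk,
        mul_inv_cancel_right, inv_inv, Equiv.Perm.sign_mul, Units.val_mul, Int.cast_mul]
      ring
    simp only [h2, ← Finset.mul_sum, h1, mul_zero]
  R21 p :=
    { carrier := {w | ∀ r ∈ Q.R21 (-p), Ind21.pair w r = 0}
      add_mem' := by
        intro v w hv hw r hr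
        have h1 := hv r hr
        have h2 := hw r hr
        simp only [Ind21.pair] at h1 h2 ⊢
        simp only [Pi.add_apply, map_add, LinearMap.add_apply, Finset.sum_add_distrib, h1, h2,
          add_zero]
      zero_mem' := by
        intro r _
        simp [Ind21.pair]
      smul_mem' := by
        intro c w hw r hr
        have h1 := hw r hr
        simp only [Ind21.pair] at h1 ⊢
        simp only [Pi.smul_apply, map_smul, LinearMap.smul_apply, smul_eq_mul, ← Finset.mul_sum,
          h1, mul_zero] }
  R21_act {p} π w hw := by
    intro r hr
    have h1 := hw _ (Q.R21_act π⁻¹ hr)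
    simp only [Ind21.pair] at h1 ⊢
    rw [← Equiv.sum_comp (Equiv.mulLeft π), ← h1]
    refine Finset.sum_congr rfl fun τ _ => ?_
    simp [Ind21.act, LinearMap.funLeft_apply]

/-- The arities and degrees of the generators of `V^(d)`. -/
def IsVGen (d : ℤ) (m n : ℕ) (p : ℤ) : Prop :=
  (m = 1 ∧ n = 2 ∧ p = 0) ∨ (m = 2 ∧ n = 0 ∧ p = d)

/-- The generators of `V^(d)`: in arity `(1,2)` the regular representation `k μ ⊕ k μ̄` of `S₂` in
degree `0`, and in arity `(2,0)` the trivial representation `k ν` in degree `d`. Both are written as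
the functions on `S_n`, the permutation `ρ` corresponding to the basis vector `δ_ρ`, with
`(π,σ) δ_ρ = δ_{ρ σ}`; so `μ = δ_1`, `μ̄ = δ_{(12)}`, and `ν = δ_1` for the only element of `S₀`. -/
def vGenerators (k : Type u) [Field k] (d : ℤ) : SBimodule k where
  obj m n p :=
    ({ carrier := {φ | ¬ IsVGen d m n p → φ = 0}
       add_mem' := fun ha hb h => by rw [ha h, hb h, add_zero]
       zero_mem' := fun _ => rfl
       smul_mem' := fun c _ ha h => by rw [ha h, smul_zero] } :
      Submodule k (Equiv.Perm (Fin n) → k))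
  act π σ :=
    { toFun := fun φ => ⟨fun τ => φ.1 (τ * σ⁻¹), fun h => by rw [φ.2 h]; rfl⟩
      map_add' := fun _ _ => rfl
      map_smul' := fun _ _ => rfl }
  act_one φ := by
    ext τ
    simp
  act_mul π π' σ σ' φ := by
    ext τ
    simp [mul_assoc]
  eq_zero_of_not_inJ0 h φ := by
    refine Subtype.ext (φ.2 fun h' => h ?_)
    rcases h' with ⟨rfl, rfl, _⟩ | ⟨rfl, rfl, _⟩ <;> simp [InJ0]

/-- The product `μ`. -/
def vMu (k : Type u) [Field k] (d : ℤ) : (vGenerators k d).obj 1 2 0 :=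
  ⟨Pi.single 1 1, fun h => absurd (Or.inl ⟨rfl, rfl, rfl⟩) h⟩

/-- The opposite product `μ̄ = μ σ`, for the transposition `σ`. -/
def vMuBar (k : Type u) [Field k] (d : ℤ) : (vGenerators k d).obj 1 2 0 :=
  (vGenerators k d).act 1 (Equiv.swap 0 1) (vMu k d)

/-- The co-inner product `ν`, of degree `d`. -/
def vNu (k : Type u) [Field k] (d : ℤ) : (vGenerators k d).obj 2 0 d :=
  ⟨Pi.single 1 1, fun h => absurd (Or.inr ⟨rfl, rfl, rfl⟩) h⟩

/-- The element `μ ₁∘₁ μ - μ ₂∘₁ μ`, where `μ ₂∘₁ μ` is the tree `(μ̄ ₁∘₁ μ) σ` for a cyclic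
permutation `σ`; see `vAssoc_toFree`. -/
def vAssoc (k : Type u) [Field k] (d : ℤ) {p : ℤ} (hp : 0 + 0 = p) : Ind13 (vGenerators k d) p :=
  Ind13.tree hp (vMu k d) (vMu k d) 1 -
    Ind13.tree hp (vMuBar k d) (vMu k d)
      (permComp (a := 2) (b := 2) (c := 3) rfl (Equiv.swap 0 1) 0 1)⁻¹

/-- The element `μ ₁∘₂ ν - μ ₂∘₁ ν`, where `μ ₁∘₂ ν` is the tree `(12) (μ ₁∘₁ ν)` and `μ ₂∘₁ ν` is the
tree `μ̄ ₁∘₁ ν`; see `vInv_toFree`. -/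
def vInv (k : Type u) [Field k] (d : ℤ) {p : ℤ} (hp : 0 + d = p) : Ind21 (vGenerators k d) p :=
  Ind21.tree hp (vMu k d) (vNu k d) (Equiv.swap 0 1) - Ind21.tree hp (vMuBar k d) (vNu k d) 1

theorem vAssoc_toFree (k : Type u) [Field k] [CharZero k] (d : ℤ) :
    Ind13.toFree (vAssoc k d (add_zero 0)) =
      (freeDioperad (vGenerators k d)).comp13 (add_zero 0) 0
          ((freeGen _).map (vMu k d)) ((freeGen _).map (vMu k d)) -
        (freeDioperad (vGenerators k d)).comp13 (add_zero 0) 1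
          ((freeGen _).map (vMu k d)) ((freeGen _).map (vMu k d)) := by
  rw [vAssoc, map_sub, Ind13.toFree_tree, Ind13.toFree_tree, (freeDioperad _).act_one]
  congr 1
  have h := (freeDioperad (vGenerators k d)).comp_act (m₁ := 1) (n₁ := 2) (m₂ := 1)
    (n₂ := 2) (m := 1) (n := 3) rfl rfl
    (add_zero (0 : ℤ)) 0 0 1 (Equiv.swap 0 1) 1 1
    ((freeGen _).map (vMu k d)) ((freeGen _).map (vMu k d))
  rw [(freeDioperad _).act_one, ← (freeGen _).map_act] at h
  rw [vMuBar, h, ← (freeDioperad _).act_mul, mul_inv_cancel]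
  have h3 : (1 : Equiv.Perm (Fin 1)) * permComp (a := 1) (b := 1) (c := 1) (by omega) 1
    ((1 : Equiv.Perm (Fin 1))⁻¹ 0) 1 = 1 := Subsingleton.elim _ _
  rw [h3, (freeDioperad _).act_one]
  rfl

theorem vInv_toFree (k : Type u) [Field k] (d : ℤ) :
    Ind21.toFree (vInv k d (zero_add d)) =
      (freeDioperad (vGenerators k d)).comp21 (zero_add d) 0 1
          ((freeGen _).map (vMu k d)) ((freeGen _).map (vNu k d)) -
        (freeDioperad (vGenerators k d)).comp21 (zero_add d) 1 0
          ((freeGen _).map (vMu k d)) ((freeGen _).map (vNu k d)) := by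
  have hν : (vGenerators k d).act (Equiv.swap 0 1) 1 (vNu k d) = vNu k d := by
    apply Subtype.ext
    funext τ
    change (vNu k d).1 (τ * 1⁻¹) = _
    rw [inv_one, mul_one]
  rw [vInv, map_sub, Ind21.toFree_tree, Ind21.toFree_tree, (freeDioperad _).act_one]
  congr 1
  · have h := (freeDioperad (vGenerators k d)).comp_act (m₁ := 1) (n₁ := 2) (m₂ := 2)
      (n₂ := 0) (m := 2) (n := 1) rfl rfl
      (zero_add d) 0 1 1 1 (Equiv.swap 0 1) 1
      ((freeGen _).map (vMu k d)) ((freeGen _).map (vNu k d))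
    rw [(freeDioperad _).act_one, ← (freeGen _).map_act, hν] at h
    rw [h]
    have h1 : permComp (a := 2) (b := 1) (c := 2) (by omega) (Equiv.swap 0 1)
      ((Equiv.swap 0 1 : Equiv.Perm (Fin 2))⁻¹ 1) 1 = Equiv.swap 0 1 := by decide
    have h2 : permComp (a := 2) (b := 0) (c := 1) rfl 1 0 1 = 1 := Subsingleton.elim _ _
    rw [h1, h2]
    rfl
  · have h := (freeDioperad (vGenerators k d)).comp_act (m₁ := 1) (n₁ := 2) (m₂ := 2)
      (n₂ := 0) (m := 2) (n := 1) rfl rfl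
      (zero_add d) 0 0 1 (Equiv.swap 0 1) 1 1
      ((freeGen _).map (vMu k d)) ((freeGen _).map (vNu k d))
    rw [(freeDioperad _).act_one, ← (freeGen _).map_act] at h
    rw [vMuBar, h]
    have h1 : permComp (a := 2) (b := 1) (c := 2) (by omega) 1
      ((1 : Equiv.Perm (Fin 2))⁻¹ 0) 1 = 1 := by decide
    have h2 : permComp (a := 2) (b := 0) (c := 1) rfl (Equiv.swap 0 1) 0 1 = 1 :=
      Subsingleton.elim _ _
    rw [h1, h2, (freeDioperad _).act_one]
    rfl

/-- The quadratic data of `V^(d)`: the relations are the submodules generated by associativity and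
invariance. -/
def vData (k : Type u) [Field k] (d : ℤ) : QuadraticData k where
  E := vGenerators k d
  eq_zero_of_ne h h' φ := by
    refine Subtype.ext (φ.2 fun h'' => ?_)
    rcases h'' with ⟨rfl, rfl, _⟩ | ⟨rfl, rfl, _⟩
    · exact h rfl
    · exact h' rfl
  R13 p := Submodule.span k {w | ∃ (hp : 0 + 0 = p) (σ : Equiv.Perm (Fin 3)),
    w = Ind13.act σ (vAssoc k d hp)}
  R13_act {p} σ w hw := by
    induction hw using Submodule.span_induction with
    | mem w hw =>
      obtain ⟨hp, σ', rfl⟩ := hw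
      refine Submodule.subset_span ⟨hp, σ' * σ, ?_⟩
      apply Subtype.ext
      funext τ
      simp [Ind13.act, mul_assoc]
    | zero => rw [map_zero]; exact Submodule.zero_mem _
    | add v w _ _ hv hw => rw [map_add]; exact Submodule.add_mem _ hv hw
    | smul c w _ hw => rw [map_smul]; exact Submodule.smul_mem _ c hw
  R21 p := Submodule.span k {w | ∃ (hp : 0 + d = p) (π : Equiv.Perm (Fin 2)),
    w = Ind21.act π (vInv k d hp)}
  R21_act {p} π w hw := by
    induction hw using Submodule.span_induction with
    | mem w hw =>
      obtain ⟨hp, π', rfl⟩ := hw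
      refine Submodule.subset_span ⟨hp, π * π', ?_⟩
      funext τ
      simp [Ind21.act, LinearMap.funLeft_apply, mul_assoc]
    | zero => rw [map_zero]; exact Submodule.zero_mem _
    | add v w _ _ hv hw => rw [map_add]; exact Submodule.add_mem _ hv hw
    | smul c w _ hw => rw [map_smul]; exact Submodule.smul_mem _ c hw

/-- The dioperad `V^(d)`. -/
def vDioperad (k : Type u) [Field k] (d : ℤ) : Dioperad k := (vData k d).dioperad

/-- The quadratic dual `(V^(d))^!`. -/
def vDualDioperad (k : Type u) [Field k] (d : ℤ) : Dioperad k := (vData k d).dual.dioperad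

/-- The generator `μ^*` of the quadratic dual: the element of the dual basis of `μ, μ̄` with value `1`
on `μ` and `0` on `μ̄`. -/
def vMuStar (k : Type u) [Field k] (d : ℤ) : (vGenerators k d).dual.obj 1 2 0 :=
  LinearMap.proj (1 : Equiv.Perm (Fin 2)) ∘ₗ Submodule.subtype _

/-- The generator `μ̄^*` of the quadratic dual, with value `0` on `μ` and `1` on `μ̄`. -/
def vMuBarStar (k : Type u) [Field k] (d : ℤ) : (vGenerators k d).dual.obj 1 2 0 :=
  LinearMap.proj (Equiv.swap 0 1 : Equiv.Perm (Fin 2)) ∘ₗ Submodule.subtype _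

/-- The generator `ν^*` of the quadratic dual, of degree `-d`, with value `1` on `ν`. -/
def vNuStar (k : Type u) [Field k] (d : ℤ) : (vGenerators k d).dual.obj 2 0 (-d) :=
  LinearMap.proj (1 : Equiv.Perm (Fin 0)) ∘ₗ Submodule.subtype _

/-- Associativity `μ ₁∘₁ μ = μ ₂∘₁ μ`. -/
def Dioperad.IsAssociative {k : Type u} [Field k] (P : Dioperad k) (μ : P.obj 1 2 0) : Prop :=
  P.comp13 (add_zero 0) 0 μ μ = P.comp13 (add_zero 0) 1 μ μ

/-- Symmetry `σ ν = ν`, for the transposition `σ`. -/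
def Dioperad.IsSymmetric {k : Type u} [Field k] (P : Dioperad k) {e : ℤ} (ν : P.obj 2 0 e) : Prop :=
  P.act (Equiv.swap 0 1) 1 ν = ν

/-- Invariance `μ ₁∘₂ ν = μ ₂∘₁ ν`. -/
def Dioperad.IsInvariant {k : Type u} [Field k] (P : Dioperad k) {e : ℤ} (μ : P.obj 1 2 0)
    (ν : P.obj 2 0 e) : Prop :=
  P.comp21 (zero_add e) 0 1 μ ν = P.comp21 (zero_add e) 1 0 μ ν

end

/-! Write `δ_ρ` for the basis vectors of the generators, so that `μ = δ_1` and `μ̄ = δ_(12)`. The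
comparison map `vToDual` sends `δ_ρ` to `sgn(ρ)` times the dual basis vector, hence `μ` to `μ^*`,
`μ̄` to `-μ̄^*` and `ν` to `ν^*`. The sign absorbs the twist by `Sgn_n`, which makes the map an
equivariant isomorphism, with inverse `vOfDual`.

A map of generators extends to free dioperads and is compatible with the inclusion of two-vertex
trees (`Ind13.toFree_map`, `Ind21.toFree_map`). An isomorphism of generators that matches the
quadratic relations therefore descends to an isomorphism of the quotients (`QuadraticData.iso`).
What remains is that the relations `R` of `V^(-d)` are carried exactly onto the orthogonal
complement of those of `V^(d)`.

This is a computation with the trees `(δ_x ₁∘₁ μ) σ` and `π (δ_x ₁∘₁ ν)`, which span. Read through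
the comparison map the pairing is diagonal on them, with entries `2 sgn(x) sgn(σ)` and `sgn(x)`
(`pair_vTree13`, `pair_vTree21`); the Koszul sign is trivial because `μ` has degree `0`, so `d`
enters only through its negation. Every relator is a tree with `x = 1` minus a tree with `x = (12)`.
Its two trees have opposite diagonal entries, since the cyclic permutation in the associativity
relator is even, and distinct relators involve disjoint pairs of trees. So relators are orthogonal
to relators (`pair_assoc_assoc`, `pair_inv_inv`), which is the inclusion of `R` in the complement.

For the converse no dimension count is needed. Modulo `R` any element is a combination of the trees
with `x = 1` (`exists_sub_mem_vRel13`, `exists_sub_mem_vRel21`), and pairing such a combination with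
a single relator isolates one coefficient. If the element is orthogonal to all relators, every
coefficient vanishes and the element was in `R`.

The relations in `V^(d)` hold by construction; those in the dual are transported from `V^(-d)` along
the isomorphism. -/

noncomputable section

variable {k : Type u} [Field k]

/-! ### Functoriality of the free dioperad. -/

/-- The composite of morphisms of collections. -/
def SBimoduleHom.comp {E F G : SBimodule k} (ψ : SBimoduleHom F G) (φ : SBimoduleHom E F) :
    SBimoduleHom E G where
  map := ψ.map ∘ₗ φ.map
  map_act π σ x := by simp only [LinearMap.comp_apply, φ.map_act, ψ.map_act]

/-- The morphism of free dioperads induced by a morphism of generators. -/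
def freeMap {E F : SBimodule k} (φ : SBimoduleHom E F) :
    DioperadHom (freeDioperad E) (freeDioperad F) :=
  freeLift ((freeGen F).comp φ)

theorem freeMap_gen {E F : SBimodule k} (φ : SBimoduleHom E F) {m n : ℕ} {p : ℤ}
    (x : E.obj m n p) :
    (freeMap φ).map ((freeGen E).map x) = (freeGen F).map (φ.map x) := rfl

/-- Evaluation in the free dioperad itself is the quotient map: both are built by the same
recursion. In other words, the lift of the inclusion of generators is the identity, which is what
the universal property needs in order to recognise identities. -/
theorem freeTerm_eval_freeGen {E : SBimodule k} {m n : ℕ} {p : ℤ} (t : FreeTerm E m n p) :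
    t.eval (freeGen E) =
      (show (freeDioperad E).obj m n p from Quotient.mk (freeSetoid E m n p) t) := by
  induction t with
  | gen x => rfl
  | zero => rfl
  | add s t hs ht => exact congrArg₂ (· + ·) hs ht
  | smul c t ht => exact congrArg (c • ·) ht
  | act π σ t ht => exact congrArg ((freeDioperad E).act π σ) ht
  | comp hm hn hp i j s t hs ht =>
    exact congrArg₂ (fun x y => (freeDioperad E).comp hm hn hp i j x y) hs ht

/-- A retraction of generators induces a retraction of free dioperads. -/
theorem freeMap_freeMap {E F : SBimodule k} (φ : SBimoduleHom E F) (ψ : SBimoduleHom F E)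
    (h : ∀ {m n : ℕ} {p : ℤ} (x : E.obj m n p), ψ.map (φ.map x) = x) {m n : ℕ} {p : ℤ}
    (x : (freeDioperad E).obj m n p) : (freeMap ψ).map ((freeMap φ).map x) = x := by
  let F₁ : DioperadHom (freeDioperad E) (freeDioperad E) :=
    { toSBimoduleHom := (freeMap ψ).toSBimoduleHom.comp (freeMap φ).toSBimoduleHom
      map_comp := fun hm hn hp i j f g => by
        simp only [SBimoduleHom.comp, LinearMap.comp_apply, DioperadHom.map_comp] }
  -- `F₁` fixes the generators, so it agrees with the lift of `freeGen E`, which is the identity.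
  have h1 := freeLift_unique (freeGen E) F₁ (fun x => by
    change (freeMap ψ).map ((freeMap φ).map ((freeGen E).map x)) = _
    rw [freeMap_gen, freeMap_gen, h]) x
  refine h1.trans ?_
  induction x using Quotient.ind with
  | _ t => exact freeTerm_eval_freeGen t

/-! ### Graded tensor products and two-vertex trees under maps of generators. -/

/-- Induction on elements of the graded tensor product. -/
theorem SBimodule.tens_induction {E : SBimodule k} {m₁ n₁ m₂ n₂ : ℕ} {p : ℤ}
    {C : E.Tens m₁ n₁ m₂ n₂ p → Prop} (zero : C 0) (add : ∀ s t, C s → C t → C (s + t))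
    (tens : ∀ {p₁ p₂ : ℤ} (hp : p₁ + p₂ = p) (f : E.obj m₁ n₁ p₁) (g : E.obj m₂ n₂ p₂),
      C (E.tens hp f g)) (t : E.Tens m₁ n₁ m₂ n₂ p) : C t := by
  refine DirectSum.induction_on
    (β := fun ab : DegPair p => E.TensComp m₁ n₁ m₂ n₂ ab.fst ab.snd) t zero ?_ add
  rintro ⟨p₁, p₂, hp⟩ x
  have key : ∀ x : E.TensComp m₁ n₁ m₂ n₂ p₁ p₂, C (E.tensIncl m₁ n₁ m₂ n₂ ⟨p₁, p₂, hp⟩ x) := by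
    intro x
    induction x using TensorProduct.induction_on with
    | zero => rw [map_zero]; exact zero
    | tmul f g => exact tens hp f g
    | add x y hx hy => rw [map_add]; exact add _ _ hx hy
  exact key x

/-- The action of a morphism of collections on graded tensor products. -/
def SBimoduleHom.tensMap {E F : SBimodule k} (φ : SBimoduleHom E F) {m₁ n₁ m₂ n₂ : ℕ} {p : ℤ} :
    E.Tens m₁ n₁ m₂ n₂ p →ₗ[k] F.Tens m₁ n₁ m₂ n₂ p :=
  E.tensLift (fun ab => F.tensIncl m₁ n₁ m₂ n₂ ab ∘ₗ TensorProduct.map φ.map φ.map)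

theorem SBimoduleHom.tensMap_tens {E F : SBimodule k} (φ : SBimoduleHom E F) {m₁ n₁ m₂ n₂ : ℕ}
    {p₁ p₂ p : ℤ} (hp : p₁ + p₂ = p) (f : E.obj m₁ n₁ p₁) (g : E.obj m₂ n₂ p₂) :
    φ.tensMap (E.tens hp f g) = F.tens hp (φ.map f) (φ.map g) := by
  rw [SBimoduleHom.tensMap, SBimodule.tens, SBimodule.tensLift_incl]
  rfl

theorem SBimoduleHom.tensMap_tensMap {E F : SBimodule k} (φ : SBimoduleHom E F)
    (ψ : SBimoduleHom F E)
    (h : ∀ {m n : ℕ} {p : ℤ} (x : E.obj m n p), ψ.map (φ.map x) = x) {m₁ n₁ m₂ n₂ : ℕ} {p : ℤ}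
    (t : E.Tens m₁ n₁ m₂ n₂ p) : ψ.tensMap (φ.tensMap t) = t := by
  induction t using SBimodule.tens_induction with
  | zero => simp only [map_zero]
  | add s t hs ht => simp only [map_add, hs, ht]
  | tens hp f g => rw [φ.tensMap_tens, ψ.tensMap_tens, h, h]

theorem SBimoduleHom.tensMap_tensAct {E F : SBimodule k} (φ : SBimoduleHom E F)
    {m₁ n₁ m₂ n₂ : ℕ} {p : ℤ} (h : Equiv.Perm (Fin n₂)) (t : E.Tens m₁ n₁ m₂ n₂ p) :
    φ.tensMap (E.tensAct h t) = F.tensAct h (φ.tensMap t) := by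
  induction t using SBimodule.tens_induction with
  | zero => simp only [map_zero]
  | add s t hs ht => simp only [map_add, hs, ht]
  | tens hp f g =>
    rw [E.tensAct_tens, φ.tensMap_tens, φ.tensMap_tens, F.tensAct_tens, φ.map_act]

theorem SBimoduleHom.tensComp13_tensMap {E F : SBimodule k} (φ : SBimoduleHom E F) {p : ℤ}
    (t : E.Tens 1 2 1 2 p) :
    F.tensComp13 (φ.tensMap t) = (freeMap φ).map (E.tensComp13 t) := by
  induction t using SBimodule.tens_induction with
  | zero => simp only [map_zero]
  | add s t hs ht => simp only [map_add, hs, ht]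
  | tens hp f g =>
    rw [φ.tensMap_tens, F.tensComp13_tens, E.tensComp13_tens, DioperadHom.map_comp,
      freeMap_gen, freeMap_gen]

theorem SBimoduleHom.tensComp21_tensMap {E F : SBimodule k} (φ : SBimoduleHom E F) {p : ℤ}
    (t : E.Tens 1 2 2 0 p) :
    F.tensComp21 (φ.tensMap t) = (freeMap φ).map (E.tensComp21 t) := by
  induction t using SBimodule.tens_induction with
  | zero => simp only [map_zero]
  | add s t hs ht => simp only [map_add, hs, ht]
  | tens hp f g =>
    rw [φ.tensMap_tens, F.tensComp21_tens, E.tensComp21_tens, DioperadHom.map_comp,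
      freeMap_gen, freeMap_gen]

/-- The action of a morphism of collections on trees of arity `(1,3)`. -/
def SBimoduleHom.ind13Map {E F : SBimodule k} (φ : SBimoduleHom E F) {p : ℤ} :
    Ind13 E p →ₗ[k] Ind13 F p where
  toFun w := ⟨fun τ => φ.tensMap (w.1 τ), fun h σ =>
    (congrArg φ.tensMap (w.2 h σ)).trans (φ.tensMap_tensAct h⁻¹ (w.1 σ))⟩
  map_add' v w := Subtype.ext (funext fun τ => map_add φ.tensMap (v.1 τ) (w.1 τ))
  map_smul' c w := Subtype.ext (funext fun τ => map_smul φ.tensMap c (w.1 τ))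

/-- The action of a morphism of collections on trees of arity `(2,1)`. -/
def SBimoduleHom.ind21Map {E F : SBimodule k} (φ : SBimoduleHom E F) {p : ℤ} :
    Ind21 E p →ₗ[k] Ind21 F p where
  toFun w := fun τ => φ.tensMap (w τ)
  map_add' v w := funext fun τ => map_add φ.tensMap (v τ) (w τ)
  map_smul' c w := funext fun τ => map_smul φ.tensMap c (w τ)

theorem SBimoduleHom.ind13Map_ind13Map {E F : SBimodule k} (φ : SBimoduleHom E F)
    (ψ : SBimoduleHom F E)
    (h : ∀ {m n : ℕ} {p : ℤ} (x : E.obj m n p), ψ.map (φ.map x) = x) {p : ℤ} (w : Ind13 E p) :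
    ψ.ind13Map (φ.ind13Map w) = w :=
  Subtype.ext (funext fun τ => φ.tensMap_tensMap ψ h (w.1 τ))

theorem SBimoduleHom.ind21Map_ind21Map {E F : SBimodule k} (φ : SBimoduleHom E F)
    (ψ : SBimoduleHom F E)
    (h : ∀ {m n : ℕ} {p : ℤ} (x : E.obj m n p), ψ.map (φ.map x) = x) {p : ℤ} (w : Ind21 E p) :
    ψ.ind21Map (φ.ind21Map w) = w :=
  funext fun τ => φ.tensMap_tensMap ψ h (w τ)

/-- Naturality of the inclusion of trees in the free dioperad. It allows compatibility with the
relations to be checked on the explicit induced modules, with no knowledge of the free dioperad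
itself. -/
theorem Ind13.toFree_map {E F : SBimodule k} (φ : SBimoduleHom E F) {p : ℤ} (w : Ind13 E p) :
    Ind13.toFree (φ.ind13Map w) = (freeMap φ).map (Ind13.toFree w) := by
  simp only [Ind13.toFree, LinearMap.smul_apply, LinearMap.sum_apply, LinearMap.comp_apply,
    LinearMap.proj_apply, Submodule.subtype_apply, map_smul, map_sum,
    (freeMap φ).map_act, ← φ.tensComp13_tensMap]
  rfl

theorem Ind21.toFree_map {E F : SBimodule k} (φ : SBimoduleHom E F) {p : ℤ} (w : Ind21 E p) :
    Ind21.toFree (φ.ind21Map w) = (freeMap φ).map (Ind21.toFree w) := by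
  simp only [Ind21.toFree, LinearMap.sum_apply, LinearMap.comp_apply,
    LinearMap.proj_apply, map_sum, (freeMap φ).map_act, ← φ.tensComp21_tensMap]
  rfl

theorem SBimoduleHom.ind13Map_tree {E F : SBimodule k} (φ : SBimoduleHom E F) {p₁ p₂ p : ℤ}
    (hp : p₁ + p₂ = p) (f : E.obj 1 2 p₁) (g : E.obj 1 2 p₂) (σ : Equiv.Perm (Fin 3)) :
    φ.ind13Map (Ind13.tree hp f g σ) = Ind13.tree hp (φ.map f) (φ.map g) σ := by
  refine Subtype.ext (funext fun τ => ?_)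
  simp only [SBimoduleHom.ind13Map, Ind13.tree, LinearMap.coe_mk, AddHom.coe_mk, map_sum]
  refine Finset.sum_congr rfl fun h _ => ?_
  split_ifs
  · rw [φ.tensMap_tens, φ.map_act]
  · exact map_zero _

theorem SBimoduleHom.ind21Map_tree {E F : SBimodule k} (φ : SBimoduleHom E F) {p₁ p₂ p : ℤ}
    (hp : p₁ + p₂ = p) (f : E.obj 1 2 p₁) (g : E.obj 2 0 p₂) (π : Equiv.Perm (Fin 2)) :
    φ.ind21Map (Ind21.tree hp f g π) = Ind21.tree hp (φ.map f) (φ.map g) π := by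
  refine funext fun τ => ?_
  change φ.tensMap (Pi.single (M := fun _ => E.Tens 1 2 2 0 p) π (E.tens hp f g) τ) =
    Pi.single (M := fun _ => F.Tens 1 2 2 0 p) π (F.tens hp (φ.map f) (φ.map g)) τ
  by_cases h : τ = π
  · subst h
    rw [Pi.single_eq_same, Pi.single_eq_same, φ.tensMap_tens]
  · rw [Pi.single_eq_of_ne h, Pi.single_eq_of_ne h, map_zero]

/-! ### Ideals and induced maps of quadratic dioperads. -/

/-- The preimage of an ideal under a morphism of dioperads. -/
def DioperadIdeal.comap {P Q : Dioperad k} (F : DioperadHom P Q) (I : DioperadIdeal Q) :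
    DioperadIdeal P where
  carrier m n p := (I.carrier m n p).comap F.map
  act_mem π σ x hx := by
    simp only [Submodule.mem_comap, F.map_act] at hx ⊢
    exact I.act_mem π σ hx
  comp_mem_left hm hn hp i j f g hf := by
    simp only [Submodule.mem_comap, F.map_comp] at hf ⊢
    exact I.comp_mem_left hm hn hp i j _ hf
  comp_mem_right hm hn hp i j f g hg := by
    simp only [Submodule.mem_comap, F.map_comp] at hg ⊢
    exact I.comp_mem_right hm hn hp i j _ hg

theorem DioperadIdeal.subset_span {P : Dioperad k} {S : ∀ m n p, Set (P.obj m n p)}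
    {m n : ℕ} {p : ℤ} {x : P.obj m n p} (hx : x ∈ S m n p) :
    x ∈ (DioperadIdeal.span S).carrier m n p := by
  simp only [DioperadIdeal.span, Submodule.mem_sInf, Set.mem_ofPred_eq]
  rintro N ⟨I, hI, rfl⟩
  exact hI m n p hx

theorem DioperadIdeal.span_le {P : Dioperad k} {S : ∀ m n p, Set (P.obj m n p)}
    {I : DioperadIdeal P} (h : ∀ m n p, S m n p ⊆ I.carrier m n p) (m n : ℕ) (p : ℤ) :
    (DioperadIdeal.span S).carrier m n p ≤ I.carrier m n p :=
  sInf_le ⟨I, h, rfl⟩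

/-- A morphism of generators which preserves the relations preserves the ideals. -/
theorem QuadraticData.freeMap_mem_ideal {Q Q' : QuadraticData k} (φ : SBimoduleHom Q.E Q'.E)
    (h13 : ∀ {p : ℤ} (w : Ind13 Q.E p), w ∈ Q.R13 p → φ.ind13Map w ∈ Q'.R13 p)
    (h21 : ∀ {p : ℤ} (w : Ind21 Q.E p), w ∈ Q.R21 p → φ.ind21Map w ∈ Q'.R21 p)
    {m n : ℕ} {p : ℤ} {x : (freeDioperad Q.E).obj m n p} (hx : x ∈ Q.ideal.carrier m n p) :
    (freeMap φ).map x ∈ Q'.ideal.carrier m n p := by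
  -- The preimage of the target ideal is an ideal, so it suffices that it contains the generating
  -- relations.
  refine DioperadIdeal.span_le (I := Q'.ideal.comap (freeMap φ)) ?_ m n p hx
  rintro m n p x (⟨w, hw⟩ | ⟨w, hw⟩)
  · change (freeMap φ).map (Ind13.toFree w) ∈ Q'.ideal.carrier _ _ _
    rw [← Ind13.toFree_map]
    exact DioperadIdeal.subset_span (.of13 _ (h13 w hw))
  · change (freeMap φ).map (Ind21.toFree w) ∈ Q'.ideal.carrier _ _ _
    rw [← Ind21.toFree_map]
    exact DioperadIdeal.subset_span (.of21 _ (h21 w hw))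

/-- The linear map of quadratic dioperads induced by a morphism of generators which preserves the
relations. -/
def QuadraticData.map {Q Q' : QuadraticData k} (φ : SBimoduleHom Q.E Q'.E)
    (h13 : ∀ {p : ℤ} (w : Ind13 Q.E p), w ∈ Q.R13 p → φ.ind13Map w ∈ Q'.R13 p)
    (h21 : ∀ {p : ℤ} (w : Ind21 Q.E p), w ∈ Q.R21 p → φ.ind21Map w ∈ Q'.R21 p)
    {m n : ℕ} {p : ℤ} : Q.dioperad.obj m n p →ₗ[k] Q'.dioperad.obj m n p :=
  (Q.ideal.carrier m n p).mapQ (Q'.ideal.carrier m n p) (freeMap φ).map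
    (fun _ hx => QuadraticData.freeMap_mem_ideal φ h13 h21 hx)

theorem QuadraticData.map_map {Q Q' : QuadraticData k} (φ : SBimoduleHom Q.E Q'.E)
    (ψ : SBimoduleHom Q'.E Q.E)
    (h : ∀ {m n : ℕ} {p : ℤ} (x : Q.E.obj m n p), ψ.map (φ.map x) = x)
    (h13 : ∀ {p : ℤ} (w : Ind13 Q.E p), w ∈ Q.R13 p → φ.ind13Map w ∈ Q'.R13 p)
    (h21 : ∀ {p : ℤ} (w : Ind21 Q.E p), w ∈ Q.R21 p → φ.ind21Map w ∈ Q'.R21 p)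
    (h13' : ∀ {p : ℤ} (w : Ind13 Q'.E p), w ∈ Q'.R13 p → ψ.ind13Map w ∈ Q.R13 p)
    (h21' : ∀ {p : ℤ} (w : Ind21 Q'.E p), w ∈ Q'.R21 p → ψ.ind21Map w ∈ Q.R21 p)
    {m n : ℕ} {p : ℤ} (x : Q.dioperad.obj m n p) :
    QuadraticData.map ψ h13' h21' (QuadraticData.map φ h13 h21 x) = x := by
  obtain ⟨x, rfl⟩ := Submodule.mkQ_surjective _ x
  exact congrArg (Q.ideal.carrier m n p).mkQ (freeMap_freeMap φ ψ h x)

/-- An isomorphism of generators under which the relations correspond induces an isomorphism of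
quadratic dioperads. -/
def QuadraticData.iso {Q Q' : QuadraticData k} (φ : SBimoduleHom Q.E Q'.E)
    (ψ : SBimoduleHom Q'.E Q.E)
    (h : ∀ {m n : ℕ} {p : ℤ} (x : Q.E.obj m n p), ψ.map (φ.map x) = x)
    (h' : ∀ {m n : ℕ} {p : ℤ} (x : Q'.E.obj m n p), φ.map (ψ.map x) = x)
    (h13 : ∀ {p : ℤ} (w : Ind13 Q.E p), w ∈ Q.R13 p → φ.ind13Map w ∈ Q'.R13 p)
    (h21 : ∀ {p : ℤ} (w : Ind21 Q.E p), w ∈ Q.R21 p → φ.ind21Map w ∈ Q'.R21 p)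
    (h13' : ∀ {p : ℤ} (w : Ind13 Q'.E p), w ∈ Q'.R13 p → ψ.ind13Map w ∈ Q.R13 p)
    (h21' : ∀ {p : ℤ} (w : Ind21 Q'.E p), w ∈ Q'.R21 p → ψ.ind21Map w ∈ Q.R21 p) :
    DioperadIso Q.dioperad Q'.dioperad where
  equiv := LinearEquiv.ofLinearMap (QuadraticData.map φ h13 h21) (QuadraticData.map ψ h13' h21')
    (LinearMap.ext fun x => QuadraticData.map_map ψ φ h' h13' h21' h13 h21 x)
    (LinearMap.ext fun x => QuadraticData.map_map φ ψ h h13 h21 h13' h21' x)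
  map_act {m n p} π σ x := by
    obtain ⟨x, rfl⟩ := Submodule.mkQ_surjective _ x
    -- On representatives the induced map is `freeMap φ` by definition, so its compatibilities pass
    -- to the quotient.
    exact congrArg (Q'.ideal.carrier m n p).mkQ ((freeMap φ).map_act π σ x)
  map_comp {m₁ n₁ m₂ n₂ m n p₁ p₂ p} hm hn hp i j f g := by
    obtain ⟨f, rfl⟩ := Submodule.mkQ_surjective _ f
    obtain ⟨g, rfl⟩ := Submodule.mkQ_surjective _ g
    exact congrArg (Q'.ideal.carrier m n p).mkQ ((freeMap φ).map_comp hm hn hp i j f g)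

/-! ### Trees as spanning sets of the induced modules. -/

/-- The graded tensor `f ⊗ g` as a bilinear function of `f` and `g`. -/
def SBimodule.tensBilin (E : SBimodule k) {m₁ n₁ m₂ n₂ : ℕ} {p₁ p₂ p : ℤ} (hp : p₁ + p₂ = p) :
    E.obj m₁ n₁ p₁ →ₗ[k] E.obj m₂ n₂ p₂ →ₗ[k] E.Tens m₁ n₁ m₂ n₂ p :=
  (TensorProduct.mk k (E.obj m₁ n₁ p₁) (E.obj m₂ n₂ p₂)).compr₂
    (E.tensIncl m₁ n₁ m₂ n₂ ⟨p₁, p₂, hp⟩)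

theorem SBimodule.tensBilin_apply (E : SBimodule k) {m₁ n₁ m₂ n₂ : ℕ} {p₁ p₂ p : ℤ}
    (hp : p₁ + p₂ = p) (f : E.obj m₁ n₁ p₁) (g : E.obj m₂ n₂ p₂) :
    E.tensBilin hp f g = E.tens hp f g := rfl

theorem upperPerm_one : upperPerm 1 = 1 := by decide

/-- The element of the induced module supported on the coset of `σ`, with value `t` at `σ`. -/
def Ind13.ofTens {E : SBimodule k} {p : ℤ} (σ : Equiv.Perm (Fin 3)) :
    E.Tens 1 2 1 2 p →ₗ[k] Ind13 E p where
  toFun t := ⟨fun τ => ∑ h : Equiv.Perm (Fin 2),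
      if τ = upperPerm h * σ then E.tensAct h⁻¹ t else 0, by
    -- Equivariance is additive in `t`, so only pure tensors matter, and there the function is the
    -- one underlying `Ind13.tree`.
    induction t using SBimodule.tens_induction with
    | zero => 
      simp only [map_zero, ite_self, Finset.sum_const_zero]
      exact (Ind13 E p).zero_mem
    | add s t hs ht =>
      refine (congrArg (· ∈ Ind13 E p) (funext fun τ => ?_)).mp ((Ind13 E p).add_mem hs ht)
      simp only [Pi.add_apply, ← Finset.sum_add_distrib, map_add]
      refine Finset.sum_congr rfl fun h _ => ?_
      split_ifs <;> simp
    | tens hp f g =>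
      simp only [E.tensAct_tens]
      exact (Ind13.tree hp f g σ).2⟩
  map_add' s t := by
    refine Subtype.ext (funext fun τ => ?_)
    simp only [Submodule.coe_add, Pi.add_apply, ← Finset.sum_add_distrib, map_add]
    refine Finset.sum_congr rfl fun h _ => ?_
    split_ifs <;> simp
  map_smul' c t := by
    refine Subtype.ext (funext fun τ => ?_)
    simp only [Submodule.coe_smul, Pi.smul_apply, Finset.smul_sum, map_smul, RingHom.id_apply]
    refine Finset.sum_congr rfl fun h _ => ?_
    split_ifs <;> simp

theorem Ind13.ofTens_tens {E : SBimodule k} {p₁ p₂ p : ℤ} (hp : p₁ + p₂ = p)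
    (f : E.obj 1 2 p₁) (g : E.obj 1 2 p₂) (σ : Equiv.Perm (Fin 3)) :
    Ind13.ofTens σ (E.tens hp f g) = Ind13.tree hp f g σ := by
  refine Subtype.ext (funext fun τ => ?_)
  simp only [Ind13.ofTens, Ind13.tree, LinearMap.coe_mk, AddHom.coe_mk, E.tensAct_tens]

/-- By equivariance `w` is recovered on a coset of `S₂` from its value at any one point. Summing
over all of `S₃` instead of over coset representatives counts each coset `|S₂| = 2` times. -/
theorem Ind13.sum_ofTens {E : SBimodule k} {p : ℤ} (w : Ind13 E p) :
    ∑ σ : Equiv.Perm (Fin 3), Ind13.ofTens σ (w.1 σ) = (2 : k) • w := by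
  have h2 : ∀ (h : Equiv.Perm (Fin 2)) (τ : Equiv.Perm (Fin 3)),
      E.tensAct h⁻¹ (w.1 (upperPerm h⁻¹ * τ)) = w.1 τ := by
    intro h τ
    rw [← w.2 h, ← mul_assoc, ← upperPerm_mul, mul_inv_cancel, upperPerm_one, one_mul]
  refine Subtype.ext (funext fun τ => ?_)
  simp only [Ind13.ofTens, LinearMap.coe_mk, AddHom.coe_mk, Submodule.coe_smul, Pi.smul_apply,
    AddSubmonoidClass.coe_finsetSum, Finset.sum_apply]
  rw [Finset.sum_comm]
  have h3 : ∀ h : Equiv.Perm (Fin 2), (∑ σ : Equiv.Perm (Fin 3),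
      if τ = upperPerm h * σ then E.tensAct h⁻¹ (w.1 σ) else 0) = w.1 τ := by
    intro h
    have h4 : upperPerm h * (upperPerm h⁻¹ * τ) = τ := by
      rw [← mul_assoc, ← upperPerm_mul, mul_inv_cancel, upperPerm_one, one_mul]
    rw [Finset.sum_eq_single (upperPerm h⁻¹ * τ), if_pos h4.symm, h2]
    · intro σ _ hσ
      refine if_neg fun h5 => hσ (mul_left_cancel (a := upperPerm h) ?_)
      rw [h4, ← h5]
    · intro hn
      exact absurd (Finset.mem_univ _) hn
  simp only [h3, Finset.sum_const, Finset.card_univ, Fintype.card_perm, Fintype.card_fin,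
    Nat.factorial_two]
  rw [← Nat.cast_smul_eq_nsmul k]
  simp

/-- The trees span the induced module. -/
theorem Ind13.mem_of_tree_mem [CharZero k] {E : SBimodule k} {p : ℤ}
    {N : Submodule k (Ind13 E p)}
    (h : ∀ {p₁ p₂ : ℤ} (hp : p₁ + p₂ = p) (f : E.obj 1 2 p₁) (g : E.obj 1 2 p₂)
      (σ : Equiv.Perm (Fin 3)), Ind13.tree hp f g σ ∈ N) (w : Ind13 E p) : w ∈ N := by
  have h1 : ∀ (σ : Equiv.Perm (Fin 3)) (t : E.Tens 1 2 1 2 p), Ind13.ofTens σ t ∈ N := by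
    intro σ t
    induction t using SBimodule.tens_induction with
    | zero => rw [map_zero]; exact N.zero_mem
    | add s t hs ht => rw [map_add]; exact N.add_mem hs ht
    | tens hp f g => rw [Ind13.ofTens_tens]; exact h hp f g σ
  -- Characteristic `0` enters here: the double counting of cosets is undone by dividing by `2`.
  have h2 : (2 : k)⁻¹ • ∑ σ : Equiv.Perm (Fin 3), Ind13.ofTens σ (w.1 σ) = w := by
    rw [Ind13.sum_ofTens, smul_smul, inv_mul_cancel₀ two_ne_zero, one_smul]
  rw [← h2]
  exact N.smul_mem _ (N.sum_mem fun σ _ => h1 σ _)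

/-- The trees span the induced module. -/
theorem Ind21.mem_of_tree_mem {E : SBimodule k} {p : ℤ} {N : Submodule k (Ind21 E p)}
    (h : ∀ {p₁ p₂ : ℤ} (hp : p₁ + p₂ = p) (f : E.obj 1 2 p₁) (g : E.obj 2 0 p₂)
      (π : Equiv.Perm (Fin 2)), Ind21.tree hp f g π ∈ N) (w : Ind21 E p) : w ∈ N := by
  have h1 : ∀ (π : Equiv.Perm (Fin 2)) (t : E.Tens 1 2 2 0 p),
      LinearMap.single k (fun _ => E.Tens 1 2 2 0 p) π t ∈ N := by
    intro π t
    induction t using SBimodule.tens_induction with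
    | zero => rw [map_zero]; exact N.zero_mem
    | add s t hs ht => rw [map_add]; exact N.add_mem hs ht
    | tens hp f g => exact h hp f g π
  have h2 : ∑ π : Equiv.Perm (Fin 2), Pi.single π (w π) = w := Finset.univ_sum_single w
  rw [← h2]
  exact N.sum_mem fun π _ => h1 π _

theorem Ind13.act_tree {E : SBimodule k} {p₁ p₂ p : ℤ} (hp : p₁ + p₂ = p)
    (f : E.obj 1 2 p₁) (g : E.obj 1 2 p₂) (σ ρ : Equiv.Perm (Fin 3)) :
    Ind13.act ρ (Ind13.tree hp f g σ) = Ind13.tree hp f g (σ * ρ) := by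
  refine Subtype.ext (funext fun τ => ?_)
  simp only [Ind13.act, Ind13.tree, LinearMap.coe_mk, AddHom.coe_mk]
  refine Finset.sum_congr rfl fun h _ => ?_
  simp only [mul_inv_eq_iff_eq_mul, mul_assoc]

theorem Ind21.act_tree {E : SBimodule k} {p₁ p₂ p : ℤ} (hp : p₁ + p₂ = p)
    (f : E.obj 1 2 p₁) (g : E.obj 2 0 p₂) (π ρ : Equiv.Perm (Fin 2)) :
    Ind21.act ρ (Ind21.tree hp f g π) = Ind21.tree hp f g (ρ * π) := by
  refine funext fun τ => ?_
  change Pi.single (M := fun _ => E.Tens 1 2 2 0 p) π (E.tens hp f g) (ρ⁻¹ * τ) =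
    Pi.single (M := fun _ => E.Tens 1 2 2 0 p) (ρ * π) (E.tens hp f g) τ
  simp only [Pi.single_apply, inv_mul_eq_iff_eq_mul]

/-- The defining identification of the induced module. It makes it possible to normalise the upper
vertex to `μ` at the cost of changing the permutation of the leaves. -/
theorem Ind13.tree_act_right {E : SBimodule k} {p₁ p₂ p : ℤ} (hp : p₁ + p₂ = p)
    (f : E.obj 1 2 p₁) (g : E.obj 1 2 p₂) (h : Equiv.Perm (Fin 2)) (σ : Equiv.Perm (Fin 3)) :
    Ind13.tree hp f (E.act 1 h g) σ = Ind13.tree hp f g (upperPerm h * σ) := by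
  refine Subtype.ext (funext fun τ => ?_)
  simp only [Ind13.tree]
  -- Substituting `h' * h` for the summation variable, the action of `h` on `g` cancels against `(h'
  -- * h)⁻¹`, leaving `h'⁻¹`.
  refine (Equiv.sum_comp (Equiv.mulRight h) _).symm.trans (Finset.sum_congr rfl fun h' _ => ?_)
  rw [Equiv.coe_mulRight, upperPerm_mul, mul_assoc, ← E.act_mul, mul_inv_rev,
    mul_inv_cancel_left, one_mul]

/-! ### The pairing on trees. -/

/-- The pairing of trees of arity `(1,3)` as a bilinear map. -/
def Ind13.pairBilin (E : SBimodule k) (p : ℤ) :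
    Ind13 E.dual p →ₗ[k] Ind13 E (-p) →ₗ[k] k :=
  LinearMap.mk₂ k Ind13.pair
    (fun v w r => by
      simp only [Ind13.pair, Submodule.coe_add, Pi.add_apply, map_add, LinearMap.add_apply,
        mul_add, Finset.sum_add_distrib])
    (fun c w r => by
      simp only [Ind13.pair, Submodule.coe_smul, Pi.smul_apply, map_smul, LinearMap.smul_apply,
        smul_eq_mul, mul_left_comm _ c, ← Finset.mul_sum])
    (fun w r s => by
      simp only [Ind13.pair, Submodule.coe_add, Pi.add_apply, map_add,
        mul_add, Finset.sum_add_distrib])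
    (fun c w r => by
      simp only [Ind13.pair, Submodule.coe_smul, Pi.smul_apply, map_smul,
        smul_eq_mul, mul_left_comm _ c, ← Finset.mul_sum])

/-- The pairing of trees of arity `(2,1)` as a bilinear map. -/
def Ind21.pairBilin (E : SBimodule k) (p : ℤ) :
    Ind21 E.dual p →ₗ[k] Ind21 E (-p) →ₗ[k] k :=
  LinearMap.mk₂ k Ind21.pair
    (fun v w r => by
      simp only [Ind21.pair, Pi.add_apply, map_add, LinearMap.add_apply, Finset.sum_add_distrib])
    (fun c w r => by
      simp only [Ind21.pair, Pi.smul_apply, map_smul, LinearMap.smul_apply,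
        smul_eq_mul, ← Finset.mul_sum])
    (fun w r s => by
      simp only [Ind21.pair, Pi.add_apply, map_add, Finset.sum_add_distrib])
    (fun c w r => by
      simp only [Ind21.pair, Pi.smul_apply, map_smul, smul_eq_mul, ← Finset.mul_sum])

/-- Each tree is supported on one coset of `S₂`, parametrised by `h` and `h'` respectively. A
contribution arises only where the two supports meet; the condition is kept unevaluated so that the
values on generators can be used to force `h = h'`. -/
theorem Ind13.pair_tree {E : SBimodule k} {p₁ p₂ p : ℤ} (hp : p₁ + p₂ = p)
    (hp' : -p₁ + -p₂ = -p) (x : E.dual.obj 1 2 p₁) (y : E.dual.obj 1 2 p₂)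
    (f : E.obj 1 2 (-p₁)) (g : E.obj 1 2 (-p₂)) (σ τ : Equiv.Perm (Fin 3)) :
    Ind13.pair (Ind13.tree hp x y σ) (Ind13.tree hp' f g τ) =
      ∑ h : Equiv.Perm (Fin 2), ∑ h' : Equiv.Perm (Fin 2),
        if upperPerm h * σ = upperPerm h' * τ then
          ((Equiv.Perm.sign (upperPerm h * σ) : ℤ) : k) * ((-1 : k) ^ (p₂ * -p₁) *
            ((show Module.Dual k (E.obj 1 2 (-p₁)) from x) f *
              (show Module.Dual k (E.obj 1 2 (-p₂)) from E.dual.act 1 h⁻¹ y) (E.act 1 h'⁻¹ g)))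
        else 0 := by
  simp only [Ind13.pair, Ind13.tree, map_sum, LinearMap.sum_apply, Finset.mul_sum]
  rw [Finset.sum_congr rfl fun _ _ => Finset.sum_comm, Finset.sum_comm]
  refine Finset.sum_congr rfl fun h _ => ?_
  rw [Finset.sum_comm]
  refine Finset.sum_congr rfl fun h' _ => ?_
  -- For fixed `h` and `h'` the first tree selects a single point of `S₃`.
  rw [Finset.sum_eq_single (upperPerm h * σ)]
  · rw [if_pos rfl]
    split_ifs
    · rw [E.pairTens_tens]
    · rw [map_zero, mul_zero]
  · intro ρ _ hρ
    rw [if_neg hρ, map_zero, LinearMap.zero_apply, mul_zero]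
  · intro hn
    exact absurd (Finset.mem_univ _) hn

theorem Ind21.pair_tree {E : SBimodule k} {p₁ p₂ p : ℤ} (hp : p₁ + p₂ = p)
    (hp' : -p₁ + -p₂ = -p) (x : E.dual.obj 1 2 p₁) (y : E.dual.obj 2 0 p₂)
    (f : E.obj 1 2 (-p₁)) (g : E.obj 2 0 (-p₂)) (π ρ : Equiv.Perm (Fin 2)) :
    Ind21.pair (Ind21.tree hp x y π) (Ind21.tree hp' f g ρ) =
      if π = ρ then (-1 : k) ^ (p₂ * -p₁) *
        ((show Module.Dual k (E.obj 1 2 (-p₁)) from x) f *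
          (show Module.Dual k (E.obj 2 0 (-p₂)) from y) g) else 0 := by
  rw [Ind21.pair, Finset.sum_eq_single π]
  · split_ifs with h
    · subst h
      rw [Ind21.tree, Ind21.tree, Pi.single_eq_same, Pi.single_eq_same, E.pairTens_tens]
    · rw [Ind21.tree, Ind21.tree, Pi.single_eq_of_ne h, map_zero]
  · intro τ _ hτ
    rw [Ind21.tree, Pi.single_eq_of_ne hτ, map_zero, LinearMap.zero_apply]
  · intro hn
    exact absurd (Finset.mem_univ _) hn

/-! ### The generators of `V^(d)` and their basis. -/

instance IsVGen.instDecidable (d : ℤ) (m n : ℕ) (p : ℤ) : Decidable (IsVGen d m n p) := by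
  unfold IsVGen; infer_instance

theorem isVGen_neg {d : ℤ} {m n : ℕ} {p : ℤ} : IsVGen (-d) m n p ↔ IsVGen d m n (-p) := by
  unfold IsVGen; omega

theorem isVGen_one_two {d p : ℤ} : IsVGen d 1 2 p ↔ p = 0 := by simp [IsVGen]

theorem isVGen_two_zero {d p : ℤ} : IsVGen d 2 0 p ↔ p = d := by simp [IsVGen]

/-- The basis vector `δ_ρ` of the generators of `V^(d)`, which is zero where there are no
generators. -/
def vDelta (k : Type u) [Field k] (d : ℤ) {m n : ℕ} {p : ℤ} (ρ : Equiv.Perm (Fin n)) :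
    (vGenerators k d).obj m n p :=
  ⟨if IsVGen d m n p then Pi.single ρ 1 else 0, fun h => if_neg h⟩

theorem vDelta_apply {d : ℤ} {m n : ℕ} {p : ℤ} (h : IsVGen d m n p) (ρ τ : Equiv.Perm (Fin n)) :
    (vDelta k d ρ : (vGenerators k d).obj m n p).1 τ = if ρ = τ then 1 else 0 := by
  change (if IsVGen d m n p then Pi.single ρ 1 else 0 : Equiv.Perm (Fin n) → k) τ = _
  rw [if_pos h, Pi.single_apply]
  simp only [eq_comm]

theorem vDelta_eq_zero {d : ℤ} {m n : ℕ} {p : ℤ} (h : ¬ IsVGen d m n p)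
    (ρ : Equiv.Perm (Fin n)) : (vDelta k d ρ : (vGenerators k d).obj m n p) = 0 :=
  Subtype.ext (if_neg h)

theorem vGenerators_eq_zero {d : ℤ} {m n : ℕ} {p : ℤ} (h : ¬ IsVGen d m n p)
    (f : (vGenerators k d).obj m n p) : f = 0 :=
  Subtype.ext (f.2 h)

theorem vMu_eq_vDelta (d : ℤ) : vMu k d = vDelta k d 1 := by
  refine Subtype.ext (funext fun τ => ?_)
  rw [vDelta_apply (isVGen_one_two.2 rfl), vMu]
  simp only [Pi.single_apply, eq_comm]

theorem vNu_eq_vDelta (d : ℤ) : vNu k d = vDelta k d 1 := by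
  refine Subtype.ext (funext fun τ => ?_)
  rw [vDelta_apply (isVGen_two_zero.2 rfl), vNu]
  simp only [Pi.single_apply, eq_comm]

theorem act_vDelta {d : ℤ} {m n : ℕ} {p : ℤ} (π : Equiv.Perm (Fin m))
    (σ ρ : Equiv.Perm (Fin n)) :
    (vGenerators k d).act π σ (vDelta k d ρ : (vGenerators k d).obj m n p) =
      vDelta k d (ρ * σ) := by
  by_cases h : IsVGen d m n p
  · refine Subtype.ext (funext fun τ => ?_)
    rw [vDelta_apply h]
    change (vDelta k d ρ : (vGenerators k d).obj m n p).1 (τ * σ⁻¹) = _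
    rw [vDelta_apply h]
    simp only [eq_mul_inv_iff_mul_eq]
  · rw [vDelta_eq_zero h, vDelta_eq_zero h, map_zero]

theorem vMuBar_eq_vDelta (d : ℤ) : vMuBar k d = vDelta k d (Equiv.swap 0 1) := by
  rw [vMuBar, vMu_eq_vDelta, act_vDelta, one_mul]

/-- Expansion in the basis `δ_ρ`. Since `vDelta` is zero wherever there are no generators, the
formula holds uniformly in all arities and degrees. -/
theorem sum_vDelta {d : ℤ} {m n : ℕ} {p : ℤ} (f : (vGenerators k d).obj m n p) :
    ∑ ρ : Equiv.Perm (Fin n), f.1 ρ • (vDelta k d ρ : (vGenerators k d).obj m n p) = f := by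
  by_cases h : IsVGen d m n p
  · refine Subtype.ext (funext fun τ => ?_)
    refine (congrFun (map_sum (Submodule.subtype _) _ _) τ).trans ?_
    rw [Finset.sum_apply, Finset.sum_eq_single τ]
    · change f.1 τ * (vDelta k d τ : (vGenerators k d).obj m n p).1 τ = f.1 τ
      rw [vDelta_apply h, if_pos rfl, mul_one]
    · intro ρ _ hρ
      change f.1 ρ * (vDelta k d ρ : (vGenerators k d).obj m n p).1 τ = 0
      rw [vDelta_apply h, if_neg hρ, mul_zero]
    · intro hn
      exact absurd (Finset.mem_univ _) hn
  · rw [vGenerators_eq_zero h f, Finset.sum_eq_zero]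
    intro ρ _
    rw [vDelta_eq_zero h, smul_zero]

/-! ### The sign-twisted identification of the generators of `V^(-d)` with the dual generators. -/

/-- The pairing `(f, g) ↦ ∑ sgn(τ) f(τ) g(τ)` of the generators of `V^(-d)` and `V^(d)`. -/
def vPairing (k : Type u) [Field k] (d : ℤ) (m n : ℕ) (p : ℤ) :
    (vGenerators k (-d)).obj m n p →ₗ[k] (vGenerators k d).obj m n (-p) →ₗ[k] k :=
  LinearMap.mk₂ k
    (fun f g => ∑ τ : Equiv.Perm (Fin n), ((Equiv.Perm.sign τ : ℤ) : k) * (f.1 τ * g.1 τ))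
    (fun f f' g => by
      rw [← Finset.sum_add_distrib]
      refine Finset.sum_congr rfl fun τ _ => ?_
      change _ * ((f.1 τ + f'.1 τ) * _) = _
      ring)
    (fun c f g => by
      rw [smul_eq_mul, Finset.mul_sum]
      refine Finset.sum_congr rfl fun τ _ => ?_
      change _ * ((c * f.1 τ) * _) = _
      ring)
    (fun f g g' => by
      rw [← Finset.sum_add_distrib]
      refine Finset.sum_congr rfl fun τ _ => ?_
      change _ * (_ * (g.1 τ + g'.1 τ)) = _
      ring)
    (fun c f g => by
      rw [smul_eq_mul, Finset.mul_sum]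
      refine Finset.sum_congr rfl fun τ _ => ?_
      change _ * (_ * (c * g.1 τ)) = _
      ring)

theorem vPairing_apply (d : ℤ) {m n : ℕ} {p : ℤ} (f : (vGenerators k (-d)).obj m n p)
    (g : (vGenerators k d).obj m n (-p)) : vPairing k d m n p f g =
      ∑ τ : Equiv.Perm (Fin n), ((Equiv.Perm.sign τ : ℤ) : k) * (f.1 τ * g.1 τ) := rfl

theorem vPairing_vDelta_right (d : ℤ) {m n : ℕ} {p : ℤ} (f : (vGenerators k (-d)).obj m n p)
    (τ : Equiv.Perm (Fin n)) :
    vPairing k d m n p f (vDelta k d τ) = ((Equiv.Perm.sign τ : ℤ) : k) * f.1 τ := by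
  by_cases h : IsVGen d m n (-p)
  · rw [vPairing_apply, Finset.sum_eq_single τ]
    · rw [vDelta_apply h, if_pos rfl, mul_one]
    · intro ρ _ hρ
      rw [vDelta_apply h, if_neg hρ.symm, mul_zero, mul_zero]
    · intro hn
      exact absurd (Finset.mem_univ _) hn
  · rw [vDelta_eq_zero h, map_zero, f.2 (fun h' => h (isVGen_neg.1 h')), Pi.zero_apply, mul_zero]

theorem vPairing_vDelta_vDelta (d : ℤ) {m n : ℕ} {p : ℤ} (h : IsVGen d m n (-p))
    (ρ τ : Equiv.Perm (Fin n)) :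
    vPairing k d m n p (vDelta k (-d) ρ) (vDelta k d τ) =
      if ρ = τ then ((Equiv.Perm.sign ρ : ℤ) : k) else 0 := by
  rw [vPairing_vDelta_right, vDelta_apply (isVGen_neg.2 h)]
  split_ifs with h1
  · rw [h1, mul_one]
  · rw [mul_zero]

theorem sign_mul_sign_cast {n : ℕ} (τ : Equiv.Perm (Fin n)) :
    ((Equiv.Perm.sign τ : ℤ) : k) * ((Equiv.Perm.sign τ : ℤ) : k) = 1 := by
  rw [← Int.cast_mul, ← Units.val_mul, Int.units_mul_self, Units.val_one, Int.cast_one]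

/-- The isomorphism from the generators of `V^(-d)` to those of the quadratic dual of `V^(d)`. -/
def vToDual (k : Type u) [Field k] (d : ℤ) :
    SBimoduleHom (vGenerators k (-d)) (vGenerators k d).dual where
  map {m n p} := vPairing k d m n p
  map_act {m n p} π σ f := by
    refine LinearMap.ext fun g => ?_
    change vPairing k d m n p _ g = ((Equiv.Perm.sign σ : ℤ) : k) *
      vPairing k d m n p f ((vGenerators k d).act π⁻¹ σ⁻¹ g)
    -- Translating the summation variable by `σ` turns `sgn(τ)` into `sgn(τ) sgn(σ)`; the extra
    -- factor is precisely the twist by `Sgn_n` in the dual action.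
    rw [vPairing_apply, vPairing_apply, Finset.mul_sum, ← Equiv.sum_comp (Equiv.mulRight σ)]
    refine Finset.sum_congr rfl fun τ _ => ?_
    change ((Equiv.Perm.sign (τ * σ) : ℤ) : k) * (f.1 (τ * σ * σ⁻¹) * g.1 (τ * σ)) =
      _ * (_ * (f.1 τ * g.1 (τ * σ⁻¹⁻¹)))
    rw [mul_inv_cancel_right, inv_inv, Equiv.Perm.sign_mul, Units.val_mul, Int.cast_mul]
    ring

/-- The inverse of `vToDual`. -/
def vOfDualMap (k : Type u) [Field k] (d : ℤ) (m n : ℕ) (p : ℤ) :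
    (vGenerators k d).dual.obj m n p →ₗ[k] (vGenerators k (-d)).obj m n p where
  toFun x := ⟨fun τ => ((Equiv.Perm.sign τ : ℤ) : k) *
      (show Module.Dual k ((vGenerators k d).obj m n (-p)) from x) (vDelta k d τ),
    fun h => funext fun τ => by
      rw [vDelta_eq_zero (fun h' => h (isVGen_neg.2 h')), map_zero, mul_zero]
      rfl⟩
  map_add' x y := Subtype.ext (funext fun τ => mul_add _ _ _)
  map_smul' c x := Subtype.ext (funext fun τ => mul_left_comm _ _ _)

theorem vOfDualMap_vToDual (d : ℤ) {m n : ℕ} {p : ℤ} (f : (vGenerators k (-d)).obj m n p) :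
    vOfDualMap k d m n p ((vToDual k d).map f) = f := by
  refine Subtype.ext (funext fun τ => ?_)
  change ((Equiv.Perm.sign τ : ℤ) : k) * vPairing k d m n p f (vDelta k d τ) = f.1 τ
  rw [vPairing_vDelta_right, ← mul_assoc, sign_mul_sign_cast, one_mul]

/-- A functional is determined by its values on the `δ_τ`, and the two signs multiply to `1`. -/
theorem vToDual_vOfDualMap (d : ℤ) {m n : ℕ} {p : ℤ} (x : (vGenerators k d).dual.obj m n p) :
    (vToDual k d).map (vOfDualMap k d m n p x) = x := by
  have key : ∀ x : Module.Dual k ((vGenerators k d).obj m n (-p)),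
      vPairing k d m n p (vOfDualMap k d m n p x) = x := by
    refine fun x => LinearMap.ext fun g => ?_
    rw [← sum_vDelta g, map_sum, map_sum]
    refine Finset.sum_congr rfl fun τ _ => ?_
    rw [map_smul, map_smul, vPairing_vDelta_right]
    change _ • (((Equiv.Perm.sign τ : ℤ) : k) * (((Equiv.Perm.sign τ : ℤ) : k) *
      x (vDelta k d τ))) = _
    rw [← mul_assoc, sign_mul_sign_cast, one_mul]
  exact key x

/-- The isomorphism from the generators of the quadratic dual of `V^(d)` to those of `V^(-d)`. -/
def vOfDual (k : Type u) [Field k] (d : ℤ) :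
    SBimoduleHom (vGenerators k d).dual (vGenerators k (-d)) where
  map {m n p} := vOfDualMap k d m n p
  map_act {m n p} π σ x := by
    -- Equivariance of the inverse is inherited from `vToDual`.
    have h := (vToDual k d).map_act π σ (vOfDualMap k d m n p x)
    rw [vToDual_vOfDualMap] at h
    rw [← h, vOfDualMap_vToDual]

theorem vToDual_vMu (d : ℤ) : (vToDual k d).map (vMu k (-d)) = vMuStar k d := by
  refine LinearMap.ext fun (g : (vGenerators k d).obj 1 2 (-0)) => ?_
  change vPairing k d 1 2 0 (vMu k (-d)) g = g.1 1
  rw [vPairing_apply, Finset.sum_eq_single 1]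
  · simp [vMu]
  · intro τ _ hτ
    simp [vMu, hτ]
  · intro hn
    exact absurd (Finset.mem_univ _) hn

/-- The identity permutation has sign `1`, so no sign appears here; for `μ̄` the transposition
contributes `-1`. -/
theorem vToDual_vMuBar (d : ℤ) : (vToDual k d).map (vMuBar k (-d)) = -vMuBarStar k d := by
  refine LinearMap.ext fun (g : (vGenerators k d).obj 1 2 (-0)) => ?_
  change vPairing k d 1 2 0 (vMuBar k (-d)) g = -g.1 (Equiv.swap 0 1)
  rw [vMuBar_eq_vDelta, vPairing_apply, Finset.sum_eq_single (Equiv.swap 0 1)]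
  · rw [vDelta_apply (isVGen_one_two.2 rfl), if_pos rfl]
    simp
  · intro τ _ hτ
    rw [vDelta_apply (isVGen_one_two.2 rfl), if_neg hτ.symm, zero_mul, mul_zero]
  · intro hn
    exact absurd (Finset.mem_univ _) hn

theorem vToDual_vNu (d : ℤ) : (vToDual k d).map (vNu k (-d)) = vNuStar k d := by
  refine LinearMap.ext fun (g : (vGenerators k d).obj 2 0 (- -d)) => ?_
  change vPairing k d 2 0 (-d) (vNu k (-d)) g = g.1 1
  rw [vPairing_apply, Fintype.sum_unique]
  simp [vNu, Subsingleton.elim (default : Equiv.Perm (Fin 0)) 1]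

theorem act_vNu (d : ℤ) (π : Equiv.Perm (Fin 2)) (σ : Equiv.Perm (Fin 0)) :
    (vGenerators k d).act π σ (vNu k d) = vNu k d := by
  rw [vNu_eq_vDelta, act_vDelta, Subsingleton.elim (1 * σ) 1]

/-- Both sides are images under the equivariant map `vToDual`, of `μ σ` and of `μ̄`, and these are
equal by definition. -/
theorem act_vMuStar (d : ℤ) :
    (vGenerators k d).dual.act 1 (Equiv.swap 0 1) (vMuStar k d) = -vMuBarStar k d := by
  rw [← vToDual_vMu, ← (vToDual k d).map_act, ← vToDual_vMuBar, vMuBar]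

theorem act_vNuStar (d : ℤ) :
    (vGenerators k d).dual.act (Equiv.swap 0 1) 1 (vNuStar k d) = vNuStar k d := by
  rw [← vToDual_vNu, ← (vToDual k d).map_act, act_vNu]

/-! ### The pairing on the trees of `V^(d)`. -/

/-- The tree `(δ_x ₁∘₁ μ) σ` of arity `(1,3)`. -/
def vTree13 (k : Type u) [Field k] (d : ℤ) {p : ℤ} (hp : 0 + 0 = p) (x : Equiv.Perm (Fin 2))
    (σ : Equiv.Perm (Fin 3)) : Ind13 (vGenerators k d) p :=
  Ind13.tree (p₁ := 0) (p₂ := 0) hp (vDelta k d x) (vDelta k d 1) σ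

/-- The tree `π (δ_x ₁∘₁ ν)` of arity `(2,1)`. -/
def vTree21 (k : Type u) [Field k] (d : ℤ) {p : ℤ} (hp : 0 + d = p) (x π : Equiv.Perm (Fin 2)) :
    Ind21 (vGenerators k d) p :=
  Ind21.tree (p₁ := 0) (p₂ := d) hp (vDelta k d x) (vDelta k d 1) π

/-- The permutation `c` for which `μ ₂∘₁ μ` is the tree `(μ̄ ₁∘₁ μ) c`. -/
def assocPerm : Equiv.Perm (Fin 3) :=
  (permComp (a := 2) (b := 2) (c := 3) rfl (Equiv.swap 0 1) 0 1)⁻¹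

/-- The parity that makes associativity self-dual: with an odd permutation the two diagonal entries
of a relator would add instead of cancelling. -/
theorem sign_assocPerm : Equiv.Perm.sign assocPerm = 1 := by decide

theorem sign_upperPerm : ∀ h, Equiv.Perm.sign (upperPerm h) = Equiv.Perm.sign h := by decide

theorem act_vAssoc (d : ℤ) {p : ℤ} (hp : 0 + 0 = p) (σ : Equiv.Perm (Fin 3)) :
    Ind13.act σ (vAssoc k d hp) =
      vTree13 k d hp 1 σ - vTree13 k d hp (Equiv.swap 0 1) (assocPerm * σ) := by
  rw [vAssoc, map_sub, Ind13.act_tree, Ind13.act_tree, one_mul, vMu_eq_vDelta, vMuBar_eq_vDelta]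
  rfl

theorem act_vInv (d : ℤ) {p : ℤ} (hp : 0 + d = p) (π : Equiv.Perm (Fin 2)) :
    Ind21.act π (vInv k d hp) =
      vTree21 k d hp 1 (π * Equiv.swap 0 1) - vTree21 k d hp (Equiv.swap 0 1) π := by
  rw [vInv, map_sub, Ind21.act_tree, Ind21.act_tree, mul_one, vMu_eq_vDelta, vMuBar_eq_vDelta,
    vNu_eq_vDelta]
  rfl

/-- Expanding both vertices in the `δ` basis and absorbing the permutation of the upper vertex into
the leaves, one is left with trees whose upper vertex is `μ`. Outside degree `0` the hypothesis is
vacuous and all trees are zero. -/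
theorem mem_of_vTree13_mem [CharZero k] {d p : ℤ} {N : Submodule k (Ind13 (vGenerators k d) p)}
    (h : ∀ (hp : 0 + 0 = p) x σ, vTree13 k d hp x σ ∈ N) (w : Ind13 (vGenerators k d) p) :
    w ∈ N := by
  refine Ind13.mem_of_tree_mem (fun {p₁ p₂} hp f g σ => ?_) w
  rw [← Ind13.ofTens_tens, ← SBimodule.tensBilin_apply]
  by_cases h1 : p₁ = 0
  · by_cases h2 : p₂ = 0
    · subst h1 h2
      rw [← sum_vDelta f, ← sum_vDelta g]
      simp only [map_sum, map_smul, LinearMap.sum_apply, LinearMap.smul_apply]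
      refine N.sum_mem fun y _ => N.smul_mem _ (N.sum_mem fun x _ => N.smul_mem _ ?_)
      rw [SBimodule.tensBilin_apply, Ind13.ofTens_tens]
      -- `δ_y` is `μ` acted on by `y`, which `Ind13.tree_act_right` moves to the leaves.
      have h3 := act_vDelta (k := k) (d := d) (p := 0) (1 : Equiv.Perm (Fin 1)) y 1
      rw [one_mul] at h3
      rw [← h3, Ind13.tree_act_right]
      exact h hp _ _
    · rw [vGenerators_eq_zero (mt isVGen_one_two.1 h2) g, map_zero, map_zero]
      exact N.zero_mem
  · rw [vGenerators_eq_zero (mt isVGen_one_two.1 h1) f, map_zero, LinearMap.zero_apply, map_zero]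
    exact N.zero_mem

theorem mem_of_vTree21_mem {d p : ℤ} {N : Submodule k (Ind21 (vGenerators k d) p)}
    (h : ∀ (hp : 0 + d = p) x π, vTree21 k d hp x π ∈ N) (w : Ind21 (vGenerators k d) p) :
    w ∈ N := by
  refine Ind21.mem_of_tree_mem (fun {p₁ p₂} hp f g π => ?_) w
  change LinearMap.single k (fun _ => (vGenerators k d).Tens 1 2 2 0 p) π
    ((vGenerators k d).tensBilin hp f g) ∈ N
  by_cases h1 : p₁ = 0
  · by_cases h2 : p₂ = d
    · subst h1 h2
      rw [← sum_vDelta f, ← sum_vDelta g]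
      simp only [map_sum, map_smul, LinearMap.sum_apply, LinearMap.smul_apply]
      refine N.sum_mem fun y _ => N.smul_mem _ (N.sum_mem fun x _ => N.smul_mem _ ?_)
      -- `S₀` is trivial, so `ν` is the only basis vector of arity `(2,0)`.
      rw [Subsingleton.elim y 1]
      exact h hp _ _
    · rw [vGenerators_eq_zero (mt isVGen_two_zero.1 h2) g, map_zero, map_zero]
      exact N.zero_mem
  · rw [vGenerators_eq_zero (mt isVGen_one_two.1 h1) f, map_zero, LinearMap.zero_apply, map_zero]
    exact N.zero_mem

/-- In the double sum of `Ind13.pair_tree`, the pairing of the lower vertices forces `x = y` and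
that of the upper vertices forces `h = h'`, hence `σ = τ`. In each of the two surviving terms the
sign of `h` occurs twice, once from the upper vertex and once from the sign of the whole
permutation, and disappears; this leaves the factor `2`. -/
theorem pair_vTree13 (d : ℤ) {p : ℤ} (hp : 0 + 0 = p) (hp' : 0 + 0 = -p)
    (x y : Equiv.Perm (Fin 2)) (σ τ : Equiv.Perm (Fin 3)) :
    Ind13.pair ((vToDual k d).ind13Map (vTree13 k (-d) hp x σ)) (vTree13 k d hp' y τ) =
      if x = y ∧ σ = τ then
        2 * (((Equiv.Perm.sign x : ℤ) : k) * ((Equiv.Perm.sign σ : ℤ) : k)) else 0 := by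
  have hg : IsVGen d 1 2 (-0) := isVGen_one_two.2 rfl
  have key : ∀ h h' : Equiv.Perm (Fin 2),
      ((-1 : k) ^ ((0 : ℤ) * -0) * (vPairing k d 1 2 0 (vDelta k (-d) x) (vDelta k d y) *
        vPairing k d 1 2 0 (vDelta k (-d) h⁻¹) (vDelta k d h'⁻¹))) =
      if x = y ∧ h = h' then
        ((Equiv.Perm.sign x : ℤ) : k) * ((Equiv.Perm.sign h : ℤ) : k) else 0 := by
    intro h h'
    rw [vPairing_vDelta_vDelta d hg, vPairing_vDelta_vDelta d hg, zero_mul, zpow_zero, one_mul,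
      ite_zero_mul_ite_zero]
    simp only [inv_inj, Equiv.Perm.sign_inv]
  rw [vTree13, vTree13, SBimoduleHom.ind13Map_tree]
  refine (Ind13.pair_tree (p₁ := 0) (p₂ := 0) hp hp' _ _ _ _ σ τ).trans ?_
  have step : ∀ h h' : Equiv.Perm (Fin 2),
      (if upperPerm h * σ = upperPerm h' * τ then
        ((Equiv.Perm.sign (upperPerm h * σ) : ℤ) : k) * ((-1 : k) ^ ((0 : ℤ) * -0) *
          (vPairing k d 1 2 0 (vDelta k (-d) x) (vDelta k d y) *
            (show Module.Dual k ((vGenerators k d).obj 1 2 (-0)) from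
              (vGenerators k d).dual.act 1 h⁻¹ ((vToDual k d).map (vDelta k (-d) 1)))
              ((vGenerators k d).act 1 h'⁻¹ (vDelta k d 1))))
        else 0) =
      if h = h' then (if x = y ∧ σ = τ then
        ((Equiv.Perm.sign x : ℤ) : k) * ((Equiv.Perm.sign σ : ℤ) : k) else 0) else 0 := by
    intro h h'
    rw [← (vToDual k d).map_act, act_vDelta, act_vDelta, one_mul, one_mul]
    change (if _ then _ * ((-1 : k) ^ ((0 : ℤ) * -0) * (_ *
      vPairing k d 1 2 0 (vDelta k (-d) h⁻¹) (vDelta k d h'⁻¹))) else 0) = _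
    rw [key]
    by_cases h1 : h = h'
    · subst h1
      by_cases h2 : σ = τ
      · subst h2
        by_cases h3 : x = y
        · simp only [h3, and_self, if_true, Equiv.Perm.sign_mul, sign_upperPerm, Units.val_mul,
            Int.cast_mul]
          -- The two occurrences of `sgn(h)` cancel.
          linear_combination (((Equiv.Perm.sign y : ℤ) : k) * ((Equiv.Perm.sign σ : ℤ) : k)) *
            sign_mul_sign_cast (k := k) h
        · simp [h3]
      · simp [h2]
    · simp [h1]
  refine (Finset.sum_congr rfl fun h _ => Finset.sum_congr rfl fun h' _ => step h h').trans ?_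
  simp only [Finset.sum_ite_eq, Finset.mem_univ, if_true, Finset.sum_const, Finset.card_univ,
    Fintype.card_perm, Fintype.card_fin, Nat.factorial_two, nsmul_eq_mul, Nat.cast_ofNat,
    mul_ite, mul_zero]

/-- Transport between equal degrees: the dual generator of degree `-d` is evaluated in degree `-
-d`, which is not `d` by definition. -/
theorem vTree21_eq (d : ℤ) {p q : ℤ} (hq : q = d) (hp : 0 + d = p) (hp' : 0 + q = p)
    (x π : Equiv.Perm (Fin 2)) :
    vTree21 k d hp x π =
      Ind21.tree (p₁ := 0) (p₂ := q) hp' (vDelta k d x) (vDelta k d 1) π := by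
  subst hq
  rfl

theorem pair_vTree21 (d : ℤ) {p : ℤ} (hp : 0 + -d = p) (hp' : 0 + d = -p)
    (x y π ρ : Equiv.Perm (Fin 2)) :
    Ind21.pair ((vToDual k d).ind21Map (vTree21 k (-d) hp x π)) (vTree21 k d hp' y ρ) =
      if x = y ∧ π = ρ then ((Equiv.Perm.sign x : ℤ) : k) else 0 := by
  have hg : IsVGen d 1 2 (-0) := isVGen_one_two.2 rfl
  have hg' : IsVGen d 2 0 (- -d) := isVGen_two_zero.2 (neg_neg d)
  have hq : 0 + - -d = -p := by omega
  rw [vTree21_eq d (neg_neg d) hp' hq, vTree21, SBimoduleHom.ind21Map_tree]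
  refine (Ind21.pair_tree (p₁ := 0) (p₂ := -d) hp hq _ _ _ _ π ρ).trans ?_
  change (if π = ρ then (-1 : k) ^ (-d * -(0 : ℤ)) *
    (vPairing k d 1 2 0 (vDelta k (-d) x) (vDelta k d y) *
      vPairing k d 2 0 (-d) (vDelta k (-d) 1) (vDelta k d 1)) else 0) = _
  rw [vPairing_vDelta_vDelta d hg, vPairing_vDelta_vDelta d hg', if_pos rfl, neg_zero, mul_zero,
    zpow_zero, one_mul, Equiv.Perm.sign_one, Units.val_one, Int.cast_one, mul_one, ← ite_and]
  simp only [and_comm]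

/-- The cross terms pair trees with different lower vertices and vanish. The diagonal terms are
nonzero only if `σ = τ`, where they are `2 sgn(σ)` and `-2 sgn(σ)`, because the transposition is odd
and `assocPerm` is even. -/
theorem pair_assoc_assoc (d : ℤ) {p : ℤ} (hp : 0 + 0 = p) (hp' : 0 + 0 = -p)
    (σ τ : Equiv.Perm (Fin 3)) :
    Ind13.pairBilin (vGenerators k d) p
      ((vToDual k d).ind13Map (Ind13.act σ (vAssoc k (-d) hp)))
      (Ind13.act τ (vAssoc k d hp')) = 0 := by
  rw [act_vAssoc, act_vAssoc]
  simp only [map_sub, LinearMap.sub_apply]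
  change Ind13.pair _ _ - Ind13.pair _ _ - (Ind13.pair _ _ - Ind13.pair _ _) = 0
  have hs : (1 : Equiv.Perm (Fin 2)) ≠ Equiv.swap 0 1 := by decide
  simp only [pair_vTree13, mul_right_inj, hs, hs.symm, false_and, if_false, true_and,
    Equiv.Perm.sign_mul, sign_assocPerm, one_mul]
  split_ifs <;> simp

/-- As for associativity: for `π = ρ` the tree with lower vertex `μ` contributes `1` and the tree
with lower vertex `μ̄` contributes `-1`. No sign comes from the permutation of the outputs. -/
theorem pair_inv_inv (d : ℤ) {p : ℤ} (hp : 0 + -d = p) (hp' : 0 + d = -p)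
    (π ρ : Equiv.Perm (Fin 2)) :
    Ind21.pairBilin (vGenerators k d) p
      ((vToDual k d).ind21Map (Ind21.act π (vInv k (-d) hp)))
      (Ind21.act ρ (vInv k d hp')) = 0 := by
  rw [act_vInv, act_vInv]
  simp only [map_sub, LinearMap.sub_apply]
  change Ind21.pair _ _ - Ind21.pair _ _ - (Ind21.pair _ _ - Ind21.pair _ _) = 0
  have hs : (1 : Equiv.Perm (Fin 2)) ≠ Equiv.swap 0 1 := by decide
  simp only [pair_vTree21, mul_left_inj, hs, hs.symm, false_and, if_false, true_and]
  split_ifs <;> simp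

/-! ### The relations and their orthogonal complement. -/

/-- The relations of arity `(1,3)` of `V^(d)`. -/
def vRel13 (k : Type u) [Field k] (d p : ℤ) : Submodule k (Ind13 (vGenerators k d) p) :=
  (vData k d).R13 p

/-- The relations of arity `(2,1)` of `V^(d)`. -/
def vRel21 (k : Type u) [Field k] (d p : ℤ) : Submodule k (Ind21 (vGenerators k d) p) :=
  (vData k d).R21 p

/-- The relations of arity `(1,3)` of the quadratic dual of `V^(d)`. -/
def vOrth13 (k : Type u) [Field k] (d p : ℤ) : Submodule k (Ind13 (vGenerators k d).dual p) :=
  (vData k d).dual.R13 p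

/-- The relations of arity `(2,1)` of the quadratic dual of `V^(d)`. -/
def vOrth21 (k : Type u) [Field k] (d p : ℤ) : Submodule k (Ind21 (vGenerators k d).dual p) :=
  (vData k d).dual.R21 p

theorem act_vAssoc_mem {d p : ℤ} (hp : 0 + 0 = p) (σ : Equiv.Perm (Fin 3)) :
    Ind13.act σ (vAssoc k d hp) ∈ vRel13 k d p :=
  Submodule.subset_span (M := Ind13 (vGenerators k d) p) ⟨hp, σ, rfl⟩

theorem act_vInv_mem {d p : ℤ} (hp : 0 + d = p) (π : Equiv.Perm (Fin 2)) :
    Ind21.act π (vInv k d hp) ∈ vRel21 k d p :=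
  Submodule.subset_span (M := Ind21 (vGenerators k d) p) ⟨hp, π, rfl⟩

theorem vAssoc_mem {d p : ℤ} (hp : 0 + 0 = p) : vAssoc k d hp ∈ vRel13 k d p := by
  have h := act_vAssoc_mem (k := k) (d := d) hp 1
  rwa [vAssoc, map_sub, Ind13.act_tree, Ind13.act_tree, mul_one, mul_one] at h

theorem vInv_mem {d p : ℤ} (hp : 0 + d = p) : vInv k d hp ∈ vRel21 k d p := by
  have h := act_vInv_mem (k := k) hp 1
  rwa [vInv, map_sub, Ind21.act_tree, Ind21.act_tree, one_mul, one_mul] at h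

theorem vRel13_le {d p : ℤ} {N : Submodule k (Ind13 (vGenerators k d) p)}
    (h : ∀ (hp : 0 + 0 = p) σ, Ind13.act σ (vAssoc k d hp) ∈ N) : vRel13 k d p ≤ N := by
  refine Submodule.span_le.2 ?_
  rintro _ ⟨hp, σ, rfl⟩
  exact h hp σ

theorem vRel21_le {d p : ℤ} {N : Submodule k (Ind21 (vGenerators k d) p)}
    (h : ∀ (hp : 0 + d = p) π, Ind21.act π (vInv k d hp) ∈ N) : vRel21 k d p ≤ N := by
  refine Submodule.span_le.2 ?_
  rintro _ ⟨hp, π, rfl⟩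
  exact h hp π

/-- Both modules of relations are spanned by translates of one relator, so by bilinearity the
orthogonality of relators is enough. -/
theorem vToDual_mem_vOrth13 (d : ℤ) {p : ℤ} (w : Ind13 (vGenerators k (-d)) p)
    (hw : w ∈ vRel13 k (-d) p) : (vToDual k d).ind13Map w ∈ vOrth13 k d p := by
  intro r hr
  suffices h : vRel13 k d (-p) ≤ LinearMap.ker
      (Ind13.pairBilin (vGenerators k d) p ((vToDual k d).ind13Map w)) from h hr
  refine vRel13_le fun hp' τ => ?_
  suffices h : vRel13 k (-d) p ≤ LinearMap.ker
      ((Ind13.pairBilin (vGenerators k d) p).flip (Ind13.act τ (vAssoc k d hp')) ∘ₗ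
        (vToDual k d).ind13Map) from h hw
  refine vRel13_le fun hp σ => ?_
  exact pair_assoc_assoc d hp hp' σ τ

theorem vToDual_mem_vOrth21 (d : ℤ) {p : ℤ} (w : Ind21 (vGenerators k (-d)) p)
    (hw : w ∈ vRel21 k (-d) p) : (vToDual k d).ind21Map w ∈ vOrth21 k d p := by
  intro r hr
  suffices h : vRel21 k d (-p) ≤ LinearMap.ker
      (Ind21.pairBilin (vGenerators k d) p ((vToDual k d).ind21Map w)) from h hr
  refine vRel21_le fun hp' ρ => ?_
  suffices h : vRel21 k (-d) p ≤ LinearMap.ker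
      ((Ind21.pairBilin (vGenerators k d) p).flip (Ind21.act ρ (vInv k d hp')) ∘ₗ
        (vToDual k d).ind21Map) from h hw
  refine vRel21_le fun hp π => ?_
  exact pair_inv_inv d hp hp' π ρ

theorem perm_fin_two_cases : ∀ x : Equiv.Perm (Fin 2), x = 1 ∨ x = Equiv.swap 0 1 := by decide

/-- Modulo associativity, every tree of arity `(1,3)` is a combination of the trees `(μ ₁∘₁ μ) σ`. -/
theorem exists_sub_mem_vRel13 [CharZero k] (d : ℤ) {p : ℤ} (hp : 0 + 0 = p)
    (w : Ind13 (vGenerators k d) p) : ∃ a : Equiv.Perm (Fin 3) → k,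
      w - ∑ σ, a σ • vTree13 k d hp 1 σ ∈ vRel13 k d p := by
  have h : w ∈ vRel13 k d p ⊔ Submodule.span k (Set.range (vTree13 k d hp 1)) := by
    refine mem_of_vTree13_mem (fun _ x σ => ?_) w
    rcases perm_fin_two_cases x with rfl | rfl
    · exact Submodule.mem_sup_right (Submodule.subset_span ⟨σ, rfl⟩)
    -- Each tree with lower vertex `μ̄` occurs in exactly one translate of associativity, which is
    -- solved for it.
    · have h1 : vTree13 k d hp (Equiv.swap 0 1) σ = vTree13 k d hp 1 (assocPerm⁻¹ * σ) -
          Ind13.act (assocPerm⁻¹ * σ) (vAssoc k d hp) := by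
        rw [act_vAssoc, mul_inv_cancel_left, sub_sub_cancel]
      rw [h1]
      exact Submodule.sub_mem _ (Submodule.mem_sup_right (Submodule.subset_span ⟨_, rfl⟩))
        (Submodule.mem_sup_left (act_vAssoc_mem hp _))
  obtain ⟨v, hv, u, hu, rfl⟩ := Submodule.mem_sup.1 h
  obtain ⟨a, rfl⟩ := (Submodule.mem_span_range_iff_exists_fun k).1 hu
  exact ⟨a, by rwa [add_sub_cancel_right]⟩

/-- Modulo invariance, every tree of arity `(2,1)` is a combination of the trees `π (μ ₁∘₁ ν)`. -/
theorem exists_sub_mem_vRel21 (d : ℤ) {p : ℤ} (hp : 0 + d = p)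
    (w : Ind21 (vGenerators k d) p) : ∃ a : Equiv.Perm (Fin 2) → k,
      w - ∑ π, a π • vTree21 k d hp 1 π ∈ vRel21 k d p := by
  have h : w ∈ vRel21 k d p ⊔ Submodule.span k (Set.range (vTree21 k d hp 1)) := by
    refine mem_of_vTree21_mem (fun _ x π => ?_) w
    rcases perm_fin_two_cases x with rfl | rfl
    · exact Submodule.mem_sup_right (Submodule.subset_span ⟨π, rfl⟩)
    · have h1 : vTree21 k d hp (Equiv.swap 0 1) π = vTree21 k d hp 1 (π * Equiv.swap 0 1) -
          Ind21.act π (vInv k d hp) := by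
        rw [act_vInv, sub_sub_cancel]
      rw [h1]
      exact Submodule.sub_mem _ (Submodule.mem_sup_right (Submodule.subset_span ⟨_, rfl⟩))
        (Submodule.mem_sup_left (act_vInv_mem hp _))
  obtain ⟨v, hv, u, hu, rfl⟩ := Submodule.mem_sup.1 h
  obtain ⟨a, rfl⟩ := (Submodule.mem_span_range_iff_exists_fun k).1 hu
  exact ⟨a, by rwa [add_sub_cancel_right]⟩

theorem sign_cast_ne_zero {n : ℕ} (τ : Equiv.Perm (Fin n)) :
    ((Equiv.Perm.sign τ : ℤ) : k) ≠ 0 :=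
  left_ne_zero_of_mul_eq_one (sign_mul_sign_cast τ)

/-- Reduce `w` modulo the relations, which are already known to be orthogonal, to a combination of
trees with lower vertex `μ`. The translate of the associator by `τ` contains only one such tree, so
orthogonality to it gives `2 sgn(τ) a τ = 0`. -/
theorem mem_vRel13_of_vToDual_mem [CharZero k] (d : ℤ) {p : ℤ} (w : Ind13 (vGenerators k (-d)) p)
    (hw : (vToDual k d).ind13Map w ∈ vOrth13 k d p) : w ∈ vRel13 k (-d) p := by
  by_cases hp : 0 + 0 = p
  · have hp' : 0 + 0 = -p := by omega
    obtain ⟨a, ha⟩ := exists_sub_mem_vRel13 (-d) hp w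
    have hu : (vToDual k d).ind13Map (∑ σ, a σ • vTree13 k (-d) hp 1 σ) ∈
        vOrth13 k d p := by
      have h1 := Submodule.sub_mem _ hw (vToDual_mem_vOrth13 d _ ha)
      rwa [← map_sub, sub_sub_cancel] at h1
    have hz : ∀ τ, a τ = 0 := by
      intro τ
      have h1 : Ind13.pairBilin (vGenerators k d) p
          ((vToDual k d).ind13Map (∑ σ, a σ • vTree13 k (-d) hp 1 σ))
          (Ind13.act τ (vAssoc k d hp')) = 0 := hu _ (act_vAssoc_mem hp' τ)
      rw [act_vAssoc] at h1
      simp only [map_sum, map_smul, map_sub, LinearMap.sum_apply, LinearMap.smul_apply] at h1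
      have h2 : ∀ (σ : Equiv.Perm (Fin 3)) y ρ, Ind13.pairBilin (vGenerators k d) p
          ((vToDual k d).ind13Map (vTree13 k (-d) hp 1 σ)) (vTree13 k d hp' y ρ) = _ :=
        fun σ y ρ => pair_vTree13 d hp hp' 1 y σ ρ
      have hs : (1 : Equiv.Perm (Fin 2)) ≠ Equiv.swap 0 1 := by decide
      simp only [h2, hs, false_and, if_false, true_and, sub_zero, smul_eq_mul, mul_ite, mul_zero,
        Finset.sum_ite_eq', Finset.mem_univ, if_true, Finset.sum_const_zero,
        Equiv.Perm.sign_one, Units.val_one, Int.cast_one, one_mul] at h1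
      simpa [sign_cast_ne_zero] using h1
    simpa [hz] using ha
  -- In a nonzero degree there are no trees at all.
  · refine mem_of_vTree13_mem (fun h => absurd h hp) w

theorem mem_vRel21_of_vToDual_mem (d : ℤ) {p : ℤ} (w : Ind21 (vGenerators k (-d)) p)
    (hw : (vToDual k d).ind21Map w ∈ vOrth21 k d p) : w ∈ vRel21 k (-d) p := by
  by_cases hp : 0 + -d = p
  · have hp' : 0 + d = -p := by omega
    obtain ⟨a, ha⟩ := exists_sub_mem_vRel21 (-d) hp w
    have hu : (vToDual k d).ind21Map (∑ π, a π • vTree21 k (-d) hp 1 π) ∈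
        vOrth21 k d p := by
      have h1 := Submodule.sub_mem _ hw (vToDual_mem_vOrth21 d _ ha)
      rwa [← map_sub, sub_sub_cancel] at h1
    have hz : ∀ ρ, a ρ = 0 := by
      intro ρ
      have h1 : Ind21.pairBilin (vGenerators k d) p
          ((vToDual k d).ind21Map (∑ π, a π • vTree21 k (-d) hp 1 π))
          -- The translate by `ρ * Equiv.swap 0 1` is chosen because its only tree with lower vertex
          -- `μ` carries the permutation `ρ`, the relator itself having `μ` at the transposition.
          (Ind21.act (ρ * Equiv.swap 0 1) (vInv k d hp')) = 0 :=
        hu _ (act_vInv_mem hp' (ρ * Equiv.swap 0 1))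
      rw [act_vInv, mul_assoc, Equiv.swap_mul_self, mul_one] at h1
      simp only [map_sum, map_smul, map_sub, LinearMap.sum_apply, LinearMap.smul_apply] at h1
      have h2 : ∀ (π : Equiv.Perm (Fin 2)) y ρ, Ind21.pairBilin (vGenerators k d) p
          ((vToDual k d).ind21Map (vTree21 k (-d) hp 1 π)) (vTree21 k d hp' y ρ) = _ :=
        fun π y ρ => pair_vTree21 d hp hp' 1 y π ρ
      have hs : (1 : Equiv.Perm (Fin 2)) ≠ Equiv.swap 0 1 := by decide
      simp only [h2, hs, false_and, if_false, true_and, sub_zero, smul_eq_mul, mul_ite, mul_zero,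
        Finset.sum_ite_eq', Finset.mem_univ, if_true, Finset.sum_const_zero,
        Equiv.Perm.sign_one, Units.val_one, Int.cast_one, mul_one] at h1
      exact h1
    simpa [hz] using ha
  · refine mem_of_vTree21_mem (fun h => absurd h hp) w

/-! ### The isomorphism and the transport of the relations. -/

/-- The isomorphism of `V^(-d)` with the quadratic dual of `V^(d)`. -/
def vDualIso (k : Type u) [Field k] [CharZero k] (d : ℤ) :
    DioperadIso (vDioperad k (-d)) (vDualDioperad k d) :=
  QuadraticData.iso (Q := vData k (-d)) (Q' := (vData k d).dual) (vToDual k d) (vOfDual k d)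
    (vOfDualMap_vToDual d) (vToDual_vOfDualMap d) (vToDual_mem_vOrth13 d) (vToDual_mem_vOrth21 d)
    -- The converse inclusion is applied to the image of `w` under `vOfDual`, which `vToDual`
    -- carries back to `w`.
    (fun w hw => mem_vRel13_of_vToDual_mem d _ ((congrArg (· ∈ vOrth13 k d _)
      ((vOfDual k d).ind13Map_ind13Map (vToDual k d) (vToDual_vOfDualMap d) w)).mpr hw))
    (fun w hw => mem_vRel21_of_vToDual_mem d _ ((congrArg (· ∈ vOrth21 k d _)
      ((vOfDual k d).ind21Map_ind21Map (vToDual k d) (vToDual_vOfDualMap d) w)).mpr hw))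

theorem vDualIso_vMu [CharZero k] (d : ℤ) :
    (vDualIso k d).equiv ((vData k (-d)).gen (vMu k (-d))) =
      (vData k d).dual.gen (vMuStar k d) :=
  congrArg (vData k d).dual.gen (vToDual_vMu d)

theorem vDualIso_vNu [CharZero k] (d : ℤ) :
    (vDualIso k d).equiv ((vData k (-d)).gen (vNu k (-d))) =
      (vData k d).dual.gen (vNuStar k d) :=
  congrArg (vData k d).dual.gen (vToDual_vNu d)

theorem vDioperad_isAssociative [CharZero k] (d : ℤ) :
    (vDioperad k d).IsAssociative ((vData k d).gen (vMu k d)) := by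
  have h : Ind13.toFree (vAssoc k d (add_zero 0)) ∈ (vData k d).ideal.carrier 1 3 0 :=
    DioperadIdeal.subset_span (.of13 _ (vAssoc_mem (add_zero 0)))
  rw [vAssoc_toFree] at h
  exact (Submodule.Quotient.eq _).2 h

theorem vDioperad_isSymmetric (d : ℤ) :
    (vDioperad k d).IsSymmetric ((vData k d).gen (vNu k d)) := by
  refine congrArg ((vData k d).ideal.carrier 2 0 d).mkQ ?_
  exact ((freeGen _).map_act _ _ _).symm.trans (congrArg _ (act_vNu d _ _))

theorem vDioperad_isInvariant (d : ℤ) :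
    (vDioperad k d).IsInvariant ((vData k d).gen (vMu k d)) ((vData k d).gen (vNu k d)) := by
  have h : Ind21.toFree (vInv k d (zero_add d)) ∈ (vData k d).ideal.carrier 2 1 d :=
    DioperadIdeal.subset_span (.of21 _ (vInv_mem (zero_add d)))
  rw [vInv_toFree] at h
  exact (Submodule.Quotient.eq _).2 h

/-- The relation is an equation between composites, and isomorphisms respect composition. This is
how the relations for the dual generators are deduced from those of `V^(-d)`. -/
theorem DioperadIso.isAssociative {P Q : Dioperad k} (Φ : DioperadIso P Q) {μ : P.obj 1 2 0}
    (h : P.IsAssociative μ) : Q.IsAssociative (Φ.equiv μ) :=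
  (Φ.map_comp ..).symm.trans ((congrArg Φ.equiv h).trans (Φ.map_comp ..))

theorem DioperadIso.isSymmetric {P Q : Dioperad k} (Φ : DioperadIso P Q) {e : ℤ}
    {ν : P.obj 2 0 e} (h : P.IsSymmetric ν) : Q.IsSymmetric (Φ.equiv ν) :=
  (Φ.map_act ..).symm.trans (congrArg Φ.equiv h)

theorem DioperadIso.isInvariant {P Q : Dioperad k} (Φ : DioperadIso P Q) {e : ℤ}
    {μ : P.obj 1 2 0} {ν : P.obj 2 0 e} (h : P.IsInvariant μ ν) :
    Q.IsInvariant (Φ.equiv μ) (Φ.equiv ν) :=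
  (Φ.map_comp ..).symm.trans ((congrArg Φ.equiv h).trans (Φ.map_comp ..))

end

theorem mainTheorem2 {k : Type u} [Field k] [CharZero k] (d : ℤ) :
    -- in `V^(d)`, the product is associative and the co-inner product is symmetric and invariant
    ((vDioperad k d).IsAssociative ((vData k d).gen (vMu k d)) ∧
      (vDioperad k d).IsSymmetric ((vData k d).gen (vNu k d)) ∧
      (vDioperad k d).IsInvariant ((vData k d).gen (vMu k d)) ((vData k d).gen (vNu k d))) ∧
    -- the symmetric group actions on the dual generators
    ((vGenerators k d).dual.act 1 (Equiv.swap 0 1) (vMuStar k d) = -vMuBarStar k d ∧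
      (vGenerators k d).dual.act (Equiv.swap 0 1) 1 (vNuStar k d) = vNuStar k d) ∧
    -- the dual generators satisfy the same relations in `(V^(d))^!`
    ((vDualDioperad k d).IsAssociative ((vData k d).dual.gen (vMuStar k d)) ∧
      (vDualDioperad k d).IsSymmetric ((vData k d).dual.gen (vNuStar k d)) ∧
      (vDualDioperad k d).IsInvariant ((vData k d).dual.gen (vMuStar k d))
        ((vData k d).dual.gen (vNuStar k d))) ∧
    -- `(V^(d))^!` is `V^(-d)`, with generators corresponding to generators
    ∃ Φ : DioperadIso (vDioperad k (-d)) (vDualDioperad k d),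
      Φ.equiv ((vData k (-d)).gen (vMu k (-d))) = (vData k d).dual.gen (vMuStar k d) ∧
      Φ.equiv ((vData k (-d)).gen (vNu k (-d))) = (vData k d).dual.gen (vNuStar k d) := by
  refine ⟨⟨vDioperad_isAssociative d, vDioperad_isSymmetric d, vDioperad_isInvariant d⟩,
    ⟨act_vMuStar d, act_vNuStar d⟩, ⟨?_, ?_, ?_⟩, vDualIso k d, vDualIso_vMu d, vDualIso_vNu d⟩
  · rw [← vDualIso_vMu]
    exact (vDualIso k d).isAssociative (vDioperad_isAssociative (-d))
  · rw [← vDualIso_vNu]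
    exact (vDualIso k d).isSymmetric (vDioperad_isSymmetric (-d))
  · rw [← vDualIso_vMu, ← vDualIso_vNu]
    exact (vDualIso k d).isInvariant (vDioperad_isInvariant (-d))
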